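/- **Conventions.** Spaces are compactly generated Hausdorff (products, subspaces and mapping spaces carry the compactly generated topologies). $\mathcal I$ is the category of the finite sets $\mathbf n=\{1,\dots,n\}$, $n\ge 0$, and injective maps, symmetric monoidal under concatenation $\sqcup$ and the block permutations $\tau_{m,n}$. An *$\mathcal I$-space* is a functor $X:\mathcal I\to\mathcal Top_*$; an *$\mathcal I$-monoid* is an $\mathcal I$-space with natural continuous maps $\mu_{m,n}:X(\mathbf m)\times X(\mathbf n)\to X(\mathbf m\sqcup\mathbf n)$ that are associative and unital with respect to the basepoint of $X(\mathbf 0)$; it is *commutative* if $\tau_{m,n*}\mu_{m,n}(x,y)=\mu_{n,m}(y,x)$. Morphisms are natural transformations of functors to pointed spaces that are compatible with $\mu$. The homotopy colimit of a diagram of spaces $F$ on a small category is the realization of the nerve of its transport category: the space of $p$-simplices is $\coprod_{c_0\to\dots\to c_p}F(c_0)$. For an $\mathcal I$-monoid $X$, $X_{h\mathcal I}=\operatorname{hocolim}_{\mathcal I}X$ is a topological monoid via $[c,x,t]\cdot[d,y,t]=[c\sqcup d,\mu(x,y),t]$, where $c,d$ are chains in $\mathcal I$, $x\in X(c_0)$,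 $y\in X(d_0)$, $t\in\Delta^p$. The classifying space $BM$ (written $B_\mu X_{h\mathcal I}$ for $M=(X_{h\mathcal I},\mu)$) of a topological monoid $M$ is the realization of its bar construction; it comes with a structure map $M\to\Omega BM$, adjoint to the map $M\times I\to BM$ that sends $(x,s)$ to the point with parameter $s$ of the edge $x$. *$\Gamma$-spaces.* For a commutative $\mathcal I$-monoid $X$ and a finite pointed set $S$ with set $\bar S$ of non-basepoints, let $D(S)$ be the category of functors $\theta$ from the poset of subsets of $\bar S$ to $\mathcal I$ for which $\theta(U)\to\theta(U\cup V)\leftarrow\theta(V)$ is a coproduct diagram of finite sets whenever $U\cap V=\emptyset$. Then $\Gamma(X)(S)=\operatorname{hocolim}_{\theta\in D(S)}\prod_{a\in\bar S}X(\theta(\{a\}))$; a pointed map $\kappa:S\to T$ acts by $\theta\mapsto(V\mapsto\theta(\kappa^{-1}V))$ and by $(g_a)_a\mapsto\big(\prod_{a\in\kappa^{-1}(b)}g_a\big)_b$, products being formed with $\mu$. For a functor $A$ from finite pointed sets to spaces, $B_\mu A(S)=|k\mapsto A([k]\wedge S)|$, with $[k]=\{0,\dots,k\}$ the $k$-simplices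 of the simplicial circle $\Delta[1]/\partial\Delta[1]$; it comes with structure maps $A(S)\to\Omega B_\mu A(S)$, given by the edges $A(S)\cong A([1]\wedge S)$. *Ring spectra.* $S^n=S^1\wedge\dots\wedge S^1$ carries the permutation action of $\Sigma_n$ ($S^0$ is the two-point space). A *commutative symmetric ring spectrum* $R$ consists of pointed spaces $R_n$ ($n\ge0$) with basepoint preserving $\Sigma_n$-actions, pointed $\Sigma_n$-maps $\eta_n:S^n\to R_n$ and pointed $\Sigma_m\times\Sigma_n$-maps $\mu_{m,n}:R_m\wedge R_n\to R_{m+n}$ such that $\mu$ is associative, $\mu_{m,n}(\eta_m\wedge\eta_n)=\eta_{m+n}$, $\mu_{0,n}(\eta_0\wedge\mathrm{id})=\mathrm{id}_{R_n}$, and $\tau_{m,n}\circ\mu_{m,n}=\mu_{n,m}\circ\mathrm{tw}$. The commutative $\mathcal I$-monoid $\Omega^\infty(R)$ has $\Omega^\infty(R)(\mathbf n)=\Omega^nR_n$ with basepoint $\eta_n$, multiplication $\mu_{m,n}(f,g)=\mu_{m,n}\circ(f\wedge g)$, and $\alpha_*f=\bar\alpha\circ\mu_{l,m}(\eta_l\wedge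 f)\circ\bar\alpha^{-1}$ for an injection $\alpha:\mathbf m\to\mathbf n$, where $l=n-m$ and $\bar\alpha:\mathbf l\sqcup\mathbf m\to\mathbf n$ is order preserving on the first $l$ letters (with image the complement of the image of $\alpha$) and is $\alpha$ on the last $m$. The commutative $\mathcal I$-monoid of units $gl_1(R)\subseteq\Omega^\infty(R)$ consists of those $f\in\Omega^\infty(R)(\mathbf n)$ for which there are $m$ and $g\in\Omega^\infty(R)(\mathbf m)$ with $\mu_{n,m}(f,g)$ and $\mu_{m,n}(g,f)$ homotopic to the basepoints $\eta_{n+m}$, $\eta_{m+n}$. $GL_1(R)$ is the topological monoid $gl_1(R)_{h\mathcal I}$. *EH-$\mathcal I$-groups.* An *EH-$\mathcal I$-group* $G$ is an $\mathcal I$-monoid in the category of topological groups that are well-pointed by the identity; in particular each $\mu_{m,n}$ is a homomorphism, $\mu_{m,n}(gg',hh')=\mu_{m,n}(g,h)\,\mu_{m,n}(g',h')$, which implies that $(G,\mu)$ is a commutative $\mathcal I$-monoid. With $\iota_m:\mathbf 0\to\mathbf m$, $G$ has *compatible inverses* if for all $m$ and $g\in G(\mathbf m)$ there is a path in $G(\mathbf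 m\sqcup\mathbf m)$ from $(\iota_m\sqcup\mathrm{id})_*(g)$ to $(\mathrm{id}\sqcup\iota_m)_*(g)$. An *action* of $G$ on $R$ consists of continuous group actions $\kappa_n:G(\mathbf n)\times R_n\to R_n$ such that (i) $\kappa_n$ preserves the basepoint of $R_n$ and is $\Sigma_n$-equivariant, and $G(\mathbf 0)$ acts trivially on $R_0$; (ii) $\kappa_{m+n}(\mu(g,h),\mu(x,y))=\mu(\kappa_m(g,x),\kappa_n(h,y))$; (iii) for the inclusion $\iota:\mathbf m\to\mathbf l\sqcup\mathbf m$ onto the last $m$ letters, $\kappa_{l+m}(\iota_*g,\mu(\eta_l(s),x))=\mu(\eta_l(s),\kappa_m(g,x))$ for $s\in S^l$. **Theorem.** Let $G$ be an EH-$\mathcal I$-group which acts via $\kappa$ on a commutative symmetric ring spectrum $R$. 1. There is a morphism of $\mathcal I$-monoids $\varphi:G\to\Omega^\infty(R)$ which sends $g\in G(\mathbf n)$ to $g\cdot\eta_n:=\kappa_n(g,\eta_n(-))\in\Omega^nR_n$. 2. If $G$ has compatible inverses, then $\varphi$ factors over a morphism $\psi:G\to gl_1(R)$ of commutative $\mathcal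 I$-monoids. The induced map of $\Gamma$-spaces $\Gamma(\psi):\Gamma(G)\to\Gamma(gl_1(R))$ deloops: it induces a map of $\Gamma$-spaces $B_\mu\Gamma(\psi):B_\mu\Gamma(G)\to B_\mu\Gamma(gl_1(R))$ which is compatible with $\Gamma(\psi)$ under the structure maps $A(S)\to\Omega B_\mu A(S)$. In particular, the map $\psi_{h\mathcal I}:G_{h\mathcal I}\to GL_1(R)$ of homotopy colimits is a continuous homomorphism of topological monoids, and it induces a map $B_\mu G_{h\mathcal I}\to BGL_1(R)$ which is compatible with $\psi_{h\mathcal I}$ under the structure maps $M\to\Omega BM$. -/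

import Mathlib

open CategoryTheory Opposite Topology

universe u v w

namespace EHI

/-! ### Compactly generated topologies -/

/-- The family of all compact Hausdorff spaces. -/
abbrev KH : CompHaus.{u} → Type u := fun K => K

instance (i j : CompHaus.{u}) : IsGeneratedBy KH.{u} (KH i × KH j) :=
  inferInstanceAs (IsGeneratedBy KH.{u} (KH (CompHaus.of (KH i × KH j))))

instance (K : CompHaus.{u}) : IsGeneratedBy KH.{u} K :=
  IsGeneratedBy.inst (X := KH.{u}) K

instance isGeneratedBy_KH (Y : Type u) [TopologicalSpace Y]
    [CompactlyGeneratedSpace Y] :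
    IsGeneratedBy KH.{u} Y where
  continuous_equiv_symm := by
    refine continuous_from_compactlyGeneratedSpace _ fun K _ _ _ g hg => ?_
    rw [IsGeneratedBy.equiv_symm_comp_continuous_iff (X := KH.{u}) (Y := KH (CompHaus.of K))]
    exact hg

theorem compactlyGeneratedSpace_of_isGeneratedBy (Y : Type u) [TopologicalSpace Y]
    [IsGeneratedBy KH.{u} Y] : CompactlyGeneratedSpace Y :=
  compactlyGeneratedSpace_of_continuous_maps fun f h =>
    (IsGeneratedBy.continuous_iff KH.{u} f).2 fun i g => h (KH i) g g.continuous

/-- `KCont f`: the map `f` is continuous on all test maps from compact Hausdorff spaces. -/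
abbrev KCont {Y : Type v} {Z : Type w} [TopologicalSpace Y] [TopologicalSpace Z] (f : Y → Z) :
    Prop := ContinuousGeneratedBy KH.{u} f

/-- The compactly generated topology associated with a topology (k-ification). -/
abbrev kTop (Y : Type u) (t : TopologicalSpace Y) : TopologicalSpace Y :=
  TopologicalSpace.generatedBy KH.{u} (tY := t)

theorem kTop_isGeneratedBy (Y : Type u) (t : TopologicalSpace Y) :
    @IsGeneratedBy _ KH.{u} _ Y (kTop Y t) :=
  (inferInstance : IsGeneratedBy KH.{u} (WithGeneratedByTopology KH.{u} Y))

theorem kTop_cg (Y : Type u) (t : TopologicalSpace Y) :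
    @CompactlyGeneratedSpace Y (kTop Y t) :=
  @compactlyGeneratedSpace_of_isGeneratedBy Y (kTop Y t) (kTop_isGeneratedBy Y t)

theorem kTop_t2 (Y : Type u) (t : TopologicalSpace Y) (h : T2Space Y) :
    @T2Space Y (kTop Y t) :=
  @T2Space.of_injective_continuous Y Y (kTop Y t) t h id Function.injective_id
    (continuous_id_iff_le.2 TopologicalSpace.generatedBy_le)

theorem kTop_continuous_iff {Y : Type u} {Z : Type v} (t : TopologicalSpace Y)
    [TopologicalSpace Z] (f : Y → Z) :
    @Continuous Y Z (kTop Y t) _ f ↔ KCont.{u} f :=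
  WithGeneratedByTopology.continuous_from_iff (X := KH.{u}) (Y := Y) f

theorem continuous_kTop_iff {Y : Type u} {Z : Type v} [TopologicalSpace Z] [IsGeneratedBy KH.{u} Z]
    (t : TopologicalSpace Y) (f : Z → Y) :
    @Continuous Z Y _ (kTop Y t) f ↔ Continuous f :=
  IsGeneratedBy.equiv_symm_comp_continuous_iff KH.{u} f

theorem kcont_kTop_iff {Y : Type u} {Z : Type v} (s : TopologicalSpace Z) (t : TopologicalSpace Y)
    (f : Z → Y) :
    @ContinuousGeneratedBy _ KH.{u} _ Z s Y (kTop Y t) f ↔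
      @ContinuousGeneratedBy _ KH.{u} _ Z s Y t f :=
  forall_congr' fun i => forall_congr' fun _ => @continuous_kTop_iff Y (KH i) _ inferInstance t _

theorem kTop_continuous_kTop_iff {Y Z : Type u} (t : TopologicalSpace Y) (s : TopologicalSpace Z)
    (f : Y → Z) :
    @Continuous Y Z (kTop Y t) (kTop Z s) f ↔ @ContinuousGeneratedBy _ KH.{u} _ Y t Z s f :=
  (@kTop_continuous_iff Y Z t (kTop Z s) f).trans (kcont_kTop_iff t s f)

theorem kTop_continuous_of_continuous {Y : Type u} {Z : Type v} {t : TopologicalSpace Y}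
    {s : TopologicalSpace Z} {f : Y → Z} (hf : @Continuous Y Z t s f) :
    @Continuous Y Z (kTop Y t) s f :=
  continuous_le_dom TopologicalSpace.generatedBy_le hf

theorem kcont_kTop_prod {Y : Type u} {Z : Type u} {T : Type w} {t : TopologicalSpace Y}
    {s : TopologicalSpace Z} {r : TopologicalSpace T} {f : Y × Z → T}
    (hf : @ContinuousGeneratedBy _ KH.{u} _ _ (@instTopologicalSpaceProd _ _ t s) _ r f) :
    @ContinuousGeneratedBy _ KH.{u} _ _ (@instTopologicalSpaceProd _ _ (kTop Y t) (kTop Z s))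
      _ r f := by
  have h : @instTopologicalSpaceProd _ _ (kTop Y t) (kTop Z s) ≤
      @instTopologicalSpaceProd _ _ t s :=
    inf_le_inf (induced_mono TopologicalSpace.generatedBy_le)
      (induced_mono TopologicalSpace.generatedBy_le)
  rintro K ⟨g, hg⟩
  exact hf (@ContinuousMap.mk _ _ _ (@instTopologicalSpaceProd _ _ t s) g (continuous_le_rng h hg))

theorem kcont_iff {Y : Type v} {Z : Type w} [TopologicalSpace Y] [TopologicalSpace Z] (f : Y → Z) :
    KCont.{u} f ↔ ∀ (K : Type u) [TopologicalSpace K] [CompactSpace K] [T2Space K] (g : K → Y),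
      Continuous g → Continuous fun k => f (g k) :=
  ⟨fun h K _ _ _ g hg => h (i := CompHaus.of K) ⟨g, hg⟩,
    fun h i g => h (KH i) g g.continuous⟩

end EHI

namespace EHI

/-! ### The category `𝓘` and `𝓘`-monoids -/

/-- The category `𝓘`: objects are the finite sets `{1, …, n}`, morphisms are injective maps. -/
structure ICat where
  /-- the cardinality -/
  card : ℕ

instance : SmallCategory ICat where
  Hom m n := Fin m.card ↪ Fin n.card
  id m := Function.Embedding.refl _
  comp f g := f.trans g

/-- The injective map underlying a morphism of `𝓘`. -/
def ICat.emb {m n : ICat} (f : m ⟶ n) : Fin m.card ↪ Fin n.card := f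

/-- The concatenation `α ⊔ β` of two injective maps. -/
def addEmb {m n m' n' : ℕ} (α : Fin m ↪ Fin m') (β : Fin n ↪ Fin n') :
    Fin (m + n) ↪ Fin (m' + n') :=
  finSumFinEquiv.symm.toEmbedding.trans ((α.sumMap β).trans finSumFinEquiv.toEmbedding)

/-- The identification of `{1, …, m}` with `{1, …, n}` for `m = n`. -/
def castEmb {m n : ℕ} (h : m = n) : Fin m ↪ Fin n := (finCongr h).toEmbedding

/-- The block permutation `τ : m ⊔ n → n ⊔ m`, moving the first `m` letters behind the last `n`
letters. -/
def flipEmb (m n : ℕ) : Fin (m + n) ↪ Fin (n + m) := finAddFlip.toEmbedding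

/-- An `𝓘`-space: a functor from `𝓘` to pointed compactly generated Hausdorff spaces. -/
structure ISpace where
  obj : ℕ → Type u
  top : ∀ n, TopologicalSpace (obj n)
  cg : ∀ n, CompactlyGeneratedSpace (obj n)
  t2 : ∀ n, T2Space (obj n)
  pt : ∀ n, obj n
  map : ∀ {m n : ℕ}, (Fin m ↪ Fin n) → obj m → obj n
  map_continuous : ∀ {m n : ℕ} (α : Fin m ↪ Fin n), Continuous (map α)
  map_pt : ∀ {m n : ℕ} (α : Fin m ↪ Fin n), map α (pt m) = pt n
  map_id : ∀ {n : ℕ} (x : obj n), map (Function.Embedding.refl _) x = x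
  map_comp : ∀ {l m n : ℕ} (α : Fin l ↪ Fin m) (β : Fin m ↪ Fin n) (x : obj l),
    map (α.trans β) x = map β (map α x)

attribute [instance] ISpace.top ISpace.cg ISpace.t2

/-- An `𝓘`-monoid. Multiplications are continuous on the compactly generated product. -/
structure IMonoid extends ISpace.{u} where
  mul : ∀ {m n : ℕ}, obj m → obj n → obj (m + n)
  mul_continuous : ∀ m n : ℕ, KCont.{u} fun p : obj m × obj n => mul p.1 p.2
  mul_natural : ∀ {m n m' n' : ℕ} (α : Fin m ↪ Fin m') (β : Fin n ↪ Fin n') (x : obj m)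
    (y : obj n), mul (map α x) (map β y) = map (addEmb α β) (mul x y)
  mul_assoc : ∀ {l m n : ℕ} (x : obj l) (y : obj m) (z : obj n),
    map (castEmb (Nat.add_assoc l m n)) (mul (mul x y) z) = mul x (mul y z)
  one_mul : ∀ {n : ℕ} (x : obj n), map (castEmb (Nat.zero_add n)) (mul (pt 0) x) = x
  mul_one : ∀ {n : ℕ} (x : obj n), map (castEmb (Nat.add_zero n)) (mul x (pt 0)) = x

/-- A commutative `𝓘`-monoid. -/
structure CommIMonoid extends IMonoid.{u} where
  mul_comm : ∀ {m n : ℕ} (x : obj m) (y : obj n), map (flipEmb m n) (mul x y) = mul y x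

/-- Morphisms of `𝓘`-monoids: natural transformations of functors to pointed spaces which are
compatible with the multiplications. (Morphisms of commutative `𝓘`-monoids are the same.) -/
structure IMonoidHom (X Y : IMonoid.{u}) where
  app : ∀ n, X.obj n → Y.obj n
  continuous : ∀ n, Continuous (app n)
  app_pt : ∀ n, app n (X.pt n) = Y.pt n
  naturality : ∀ {m n : ℕ} (α : Fin m ↪ Fin n) (x : X.obj m),
    app n (X.map α x) = Y.map α (app m x)
  app_mul : ∀ {m n : ℕ} (x : X.obj m) (y : X.obj n),
    app (m + n) (X.mul x y) = Y.mul (app m x) (app n y)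

namespace IMonoid

variable (X : IMonoid.{u})

/-- The product of `x` and `y`, transported along an injective map defined on the disjoint
union. -/
def mulE {m n N : ℕ} (e : Fin m ⊕ Fin n ↪ Fin N) (x : X.obj m) (y : X.obj n) : X.obj N :=
  X.map (finSumFinEquiv.symm.toEmbedding.trans e) (X.mul x y)

theorem mul_eq_mulE {m n : ℕ} (x : X.obj m) (y : X.obj n) :
    X.mul x y = X.mulE finSumFinEquiv.toEmbedding x y := by
  have : finSumFinEquiv.symm.toEmbedding.trans (finSumFinEquiv (m := m) (n := n)).toEmbedding
      = Function.Embedding.refl _ := by ext i; simp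
  rw [mulE, this, X.map_id]

theorem map_mulE {m n N N' : ℕ} (e : Fin m ⊕ Fin n ↪ Fin N) (f : Fin N ↪ Fin N') (x : X.obj m)
    (y : X.obj n) : X.map f (X.mulE e x y) = X.mulE (e.trans f) x y := by
  rw [mulE, mulE, ← X.map_comp]; rfl

theorem mulE_map {m n m' n' N : ℕ} (e : Fin m' ⊕ Fin n' ↪ Fin N) (f : Fin m ↪ Fin m')
    (g : Fin n ↪ Fin n') (x : X.obj m) (y : X.obj n) :
    X.mulE e (X.map f x) (X.map g y) = X.mulE ((f.sumMap g).trans e) x y := by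
  rw [mulE, X.mul_natural, ← X.map_comp, mulE]
  congr 1
  ext i
  simp [addEmb]

theorem mulE_map_left {m n m' N : ℕ} (e : Fin m' ⊕ Fin n ↪ Fin N) (f : Fin m ↪ Fin m')
    (x : X.obj m) (y : X.obj n) :
    X.mulE e (X.map f x) y = X.mulE ((f.sumMap (.refl _)).trans e) x y := by
  rw [← mulE_map, X.map_id]

theorem mulE_map_right {m n n' N : ℕ} (e : Fin m ⊕ Fin n' ↪ Fin N)
    (g : Fin n ↪ Fin n') (x : X.obj m) (y : X.obj n) :
    X.mulE e x (X.map g y) = X.mulE ((Function.Embedding.sumMap (.refl _) g).trans e) x y := by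
  rw [← mulE_map, X.map_id]

theorem mulE_pt_left {m n N : ℕ} (e : Fin m ⊕ Fin n ↪ Fin N) (y : X.obj n) :
    X.mulE e (X.pt m) y = X.map (Function.Embedding.inr.trans e) y := by
  have h0 := X.map_pt (⟨Fin.elim0, fun i => i.elim0⟩ : Fin 0 ↪ Fin m)
  rw [← h0, mulE_map_left]
  conv_rhs => rw [← X.one_mul y]
  rw [mulE, ← X.map_comp]
  congr 1
  ext i
  obtain ⟨i, rfl⟩ := finSumFinEquiv.surjective i
  rcases i with i | i
  · exact i.elim0
  · have : castEmb (Nat.zero_add n) (finSumFinEquiv (m := 0) (Sum.inr i)) = i := by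
      ext; simp [castEmb]
    simp only [Function.Embedding.trans_apply, this, Equiv.coe_toEmbedding,
      Equiv.symm_apply_apply]
    rfl

theorem mulE_pt_right {m n N : ℕ} (e : Fin m ⊕ Fin n ↪ Fin N) (x : X.obj m) :
    X.mulE e x (X.pt n) = X.map (Function.Embedding.inl.trans e) x := by
  have h0 := X.map_pt (⟨Fin.elim0, fun i => i.elim0⟩ : Fin 0 ↪ Fin n)
  rw [← h0, mulE_map_right]
  conv_rhs => rw [← X.mul_one x]
  rw [mulE, ← X.map_comp]
  congr 1
  ext i
  obtain ⟨i, rfl⟩ := finSumFinEquiv.surjective i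
  rcases i with i | i
  · have : castEmb (Nat.add_zero m) (finSumFinEquiv (n := 0) (Sum.inl i)) = i := rfl
    simp only [Function.Embedding.trans_apply, this, Equiv.coe_toEmbedding,
      Equiv.symm_apply_apply]
    rfl
  · exact i.elim0

theorem mulE_assoc {l m n a b N : ℕ} (e : Fin a ⊕ Fin n ↪ Fin N) (f : Fin l ⊕ Fin m ↪ Fin a)
    (e' : Fin l ⊕ Fin b ↪ Fin N) (f' : Fin m ⊕ Fin n ↪ Fin b)
    (h₁ : ∀ i, e (Sum.inl (f (Sum.inl i))) = e' (Sum.inl i))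
    (h₂ : ∀ i, e (Sum.inl (f (Sum.inr i))) = e' (Sum.inr (f' (Sum.inl i))))
    (h₃ : ∀ i, e (Sum.inr i) = e' (Sum.inr (f' (Sum.inr i))))
    (x : X.obj l) (y : X.obj m) (z : X.obj n) :
    X.mulE e (X.mulE f x y) z = X.mulE e' x (X.mulE f' y z) := by
  conv_lhs => rw [mulE, mulE]
  conv_rhs => rw [mulE, mulE]
  have h1 := X.mul_natural (finSumFinEquiv.symm.toEmbedding.trans f) (.refl _) (X.mul x y) z
  have h2 := X.mul_natural (.refl _) (finSumFinEquiv.symm.toEmbedding.trans f') x (X.mul y z)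
  rw [X.map_id] at h1 h2
  rw [h1, h2, ← X.mul_assoc, ← X.map_comp, ← X.map_comp, ← X.map_comp]
  congr 1
  ext i
  obtain ⟨i, rfl⟩ := finSumFinEquiv.surjective i
  rcases i with i | i
  · obtain ⟨i, rfl⟩ := finSumFinEquiv.surjective i
    rcases i with i | i
    · have : castEmb (Nat.add_assoc l m n) (finSumFinEquiv (Sum.inl (finSumFinEquiv (Sum.inl i))))
          = finSumFinEquiv (Sum.inl i) := by ext; simp [castEmb]
      simp only [Function.Embedding.trans_apply, addEmb, this]
      simp [h₁]
    · have : castEmb (Nat.add_assoc l m n) (finSumFinEquiv (Sum.inl (finSumFinEquiv (Sum.inr i))))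
          = finSumFinEquiv (Sum.inr (finSumFinEquiv (Sum.inl i))) := by ext; simp [castEmb]
      simp only [Function.Embedding.trans_apply, addEmb, this]
      simp [h₂]
  · have : castEmb (Nat.add_assoc l m n) (finSumFinEquiv (Sum.inr i))
        = finSumFinEquiv (Sum.inr (finSumFinEquiv (Sum.inr i))) := by
      ext; simp [castEmb, Nat.add_assoc]
    simp only [Function.Embedding.trans_apply, addEmb, this]
    simp [h₃]

theorem mulE_continuous {m n N : ℕ} (e : Fin m ⊕ Fin n ↪ Fin N) :
    KCont.{u} fun p : X.obj m × X.obj n => X.mulE e p.1 p.2 :=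
  ((X.map_continuous _).continuousGeneratedBy).comp (X.mul_continuous m n)

end IMonoid

theorem CommIMonoid.mulE_comm (X : CommIMonoid.{u}) {m n N : ℕ} (e : Fin m ⊕ Fin n ↪ Fin N)
    (x : X.obj m) (y : X.obj n) :
    X.mulE e x y = X.mulE ((Equiv.sumComm _ _).toEmbedding.trans e) y x := by
  rw [IMonoid.mulE, IMonoid.mulE, ← X.mul_comm x y, ← X.map_comp]
  congr 1
  ext i
  obtain ⟨i, rfl⟩ := finSumFinEquiv.surjective i
  rcases i with i | i <;> simp [flipEmb, -finSumFinEquiv_apply_left, -finSumFinEquiv_apply_right, finAddFlip]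

theorem IMonoidHom.app_mulE {X Y : IMonoid.{u}} (φ : IMonoidHom X Y) {m n N : ℕ}
    (e : Fin m ⊕ Fin n ↪ Fin N) (x : X.obj m) (y : X.obj n) :
    φ.app N (X.mulE e x y) = Y.mulE e (φ.app m x) (φ.app n y) := by
  rw [IMonoid.mulE, φ.naturality, φ.app_mul]; rfl

end EHI

namespace EHI

/-- A map which is continuous on compact Hausdorff test spaces is continuous along maps from
compact Hausdorff spaces in the lowest universe. -/
theorem kcont_comp {Y : Type v} {Z : Type w} [TopologicalSpace Y] [TopologicalSpace Z] {f : Y → Z}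
    (hf : KCont.{u} f) {C : Type} [TopologicalSpace C] [CompactSpace C] [T2Space C] {g : C → Y}
    (hg : Continuous g) : Continuous fun c => f (g c) :=
  ((kcont_iff f).1 hf (ULift.{u} C) (fun c => g c.down) (by fun_prop)).comp continuous_uliftUp

/-! ### Units of a commutative `𝓘`-monoid -/

namespace IMonoid

variable (X : IMonoid.{u})

/-- `x` has a stable inverse: there is `y` such that `xy` and `yx` are homotopic to the respective
base points. -/
def HasStableInverse {n : ℕ} (x : X.obj n) : Prop :=
  ∃ (m : ℕ) (y : X.obj m), Joined (X.mul x y) (X.pt (n + m)) ∧ Joined (X.mul y x) (X.pt (m + n))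

theorem joined_mulE {m n N : ℕ} (e : Fin m ⊕ Fin n ↪ Fin N) {x x' : X.obj m} {y y' : X.obj n}
    (hx : Joined x x') (hy : Joined y y') : Joined (X.mulE e x y) (X.mulE e x' y') := by
  obtain ⟨p⟩ := hx
  obtain ⟨q⟩ := hy
  exact ⟨⟨⟨fun t => X.mulE e (p t) (q t),
    kcont_comp (X.mulE_continuous e) (g := fun t => (p t, q t)) (by fun_prop)⟩,
    by simp, by simp⟩⟩

theorem joined_mul_middle {a b c d : ℕ} {x : X.obj a} {y : X.obj b} {y' : X.obj c} {x' : X.obj d}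
    (hy : Joined (X.mul y y') (X.pt (b + c))) (hx : Joined (X.mul x x') (X.pt (a + d))) :
    Joined (X.mul (X.mul x y) (X.mul y' x')) (X.pt ((a + b) + (c + d))) := by
  -- the embeddings of the re-bracketed product
  let E : Fin b ⊕ Fin (c + d) ↪ Fin (b + (c + d)) := finSumFinEquiv.toEmbedding
  let f : Fin a ⊕ Fin (b + (c + d)) ↪ Fin ((a + b) + (c + d)) :=
    (finSumFinEquiv.trans (finCongr (Nat.add_assoc _ _ _).symm)).toEmbedding
  let g : Fin (b + c) ⊕ Fin d ↪ Fin (b + (c + d)) :=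
    (finSumFinEquiv.trans (finCongr (Nat.add_assoc _ _ _))).toEmbedding
  have h1 : X.mul (X.mul x y) (X.mul y' x') = X.mulE f x (X.mulE E y (X.mul y' x')) := by
    rw [X.mul_eq_mulE (X.mul x y), X.mul_eq_mulE x y]
    refine X.mulE_assoc _ _ _ _ ?_ ?_ ?_ _ _ _ <;> intro i <;> ext <;>
      simp [f, E, Nat.add_assoc]
  have h2 : X.mulE E y (X.mul y' x') = X.mulE g (X.mul y y') x' := by
    rw [X.mul_eq_mulE y' x', X.mul_eq_mulE y y']
    refine (X.mulE_assoc _ _ _ _ ?_ ?_ ?_ _ _ _).symm <;> intro i <;> ext <;>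
      simp [g, E, Nat.add_assoc]
  rw [h1, h2]
  have h3 := X.joined_mulE f (Joined.refl x) (X.joined_mulE g hy (Joined.refl x'))
  refine h3.trans ?_
  rw [X.mulE_pt_left, X.mulE_map_right]
  have h4 := hx.map (X.map_continuous (finSumFinEquiv.symm.toEmbedding.trans
    ((Function.Embedding.sumMap (.refl _) (Function.Embedding.inr.trans g)).trans f)))
  rw [X.map_pt] at h4
  exact h4

theorem HasStableInverse.mul {X : IMonoid.{u}} {m n : ℕ} {x : X.obj m} {y : X.obj n}
    (hx : X.HasStableInverse x) (hy : X.HasStableInverse y) :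
    X.HasStableInverse (X.mul x y) := by
  obtain ⟨m', x', h1, h2⟩ := hx
  obtain ⟨n', y', h3, h4⟩ := hy
  exact ⟨n' + m', X.mul y' x', X.joined_mul_middle h3 h1, X.joined_mul_middle h2 h4⟩

theorem HasStableInverse.map {X : IMonoid.{u}} {m n : ℕ} {x : X.obj m}
    (hx : X.HasStableInverse x) (α : Fin m ↪ Fin n) : X.HasStableInverse (X.map α x) := by
  obtain ⟨m', x', h1, h2⟩ := hx
  refine ⟨m', x', ?_, ?_⟩
  · have := h1.map (X.map_continuous (addEmb α (.refl _)))
    rwa [← X.mul_natural, X.map_id, X.map_pt] at this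
  · have := h2.map (X.map_continuous (addEmb (.refl _) α))
    rwa [← X.mul_natural, X.map_id, X.map_pt] at this

theorem hasStableInverse_pt (n : ℕ) : X.HasStableInverse (X.pt n) := by
  have h : X.mul (X.pt n) (X.pt n) = X.pt (n + n) := by
    rw [mul_eq_mulE, mulE_pt_left, X.map_pt]
  exact ⟨n, X.pt n, h ▸ Joined.refl _, h ▸ Joined.refl _⟩

end IMonoid

/-- The commutative `𝓘`-monoid of units of a commutative `𝓘`-monoid: the subspaces (in the category
of compactly generated spaces) of all elements with a stable inverse. -/
def CommIMonoid.units (X : CommIMonoid.{u}) : CommIMonoid.{u} where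
  obj n := {x : X.obj n // X.HasStableInverse x}
  top n := kTop _ instTopologicalSpaceSubtype
  cg n := kTop_cg _ _
  t2 n := kTop_t2 _ _ inferInstance
  pt n := ⟨X.pt n, X.hasStableInverse_pt n⟩
  map α x := ⟨X.map α x.1, x.2.map α⟩
  map_continuous α := (kTop_continuous_kTop_iff _ _ _).2
    (((X.map_continuous α).comp continuous_subtype_val).subtype_mk _).continuousGeneratedBy
  map_pt α := Subtype.ext (X.map_pt α)
  map_id x := Subtype.ext (X.map_id x.1)
  map_comp α β x := Subtype.ext (X.map_comp α β x.1)
  mul x y := ⟨X.mul x.1 y.1, x.2.mul y.2⟩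
  mul_continuous m n := by
    refine (kcont_kTop_iff _ _ _).2 (kcont_kTop_prod fun K g => Continuous.subtype_mk ?_ _)
    exact (kcont_iff _).1 (X.mul_continuous m n) (KH K) (fun k => ((g k).1.1, (g k).2.1))
      (by fun_prop)
  mul_natural α β x y := Subtype.ext (X.mul_natural α β x.1 y.1)
  mul_assoc x y z := Subtype.ext (X.mul_assoc x.1 y.1 z.1)
  one_mul x := Subtype.ext (X.one_mul x.1)
  mul_one x := Subtype.ext (X.mul_one x.1)
  mul_comm x y := Subtype.ext (X.mul_comm x.1 y.1)

/-! ### Eckmann–Hilton `𝓘`-groups -/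

/-- `Y` is well-pointed by `y₀`: the inclusion of `y₀` is a closed cofibration, expressed through
a representation of `(Y, {y₀})` as an NDR pair. -/
def WellPointed (Y : Type u) [TopologicalSpace Y] (y₀ : Y) : Prop :=
  ∃ (d : Y → unitInterval) (h : unitInterval × Y → Y), Continuous d ∧ Continuous h ∧ (∀ y, d y = 0 ↔ y = y₀) ∧
    (∀ y, h (0, y) = y) ∧ (∀ t, h (t, y₀) = y₀) ∧ ∀ y, d y < 1 → h (1, y) = y₀

/-- An Eckmann–Hilton `𝓘`-group: a functor `G` from `𝓘` to well-pointed topological groups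
(group objects in compactly generated Hausdorff spaces), which is an `𝓘`-monoid in this category
(so that the maps `mu` are natural, continuous, associative and unital) and in which the group
multiplications `ν` and the monoid multiplications `μ` satisfy the interchange law. -/
structure EHIGroup where
  obj : ℕ → Type u
  top : ∀ n, TopologicalSpace (obj n)
  cg : ∀ n, CompactlyGeneratedSpace (obj n)
  t2 : ∀ n, T2Space (obj n)
  grp : ∀ n, Group (obj n)
  nu_continuous : ∀ n, KCont.{u} fun p : obj n × obj n => p.1 * p.2
  inv_continuous : ∀ n, Continuous fun g : obj n => g⁻¹
  wellPointed : ∀ n, WellPointed (obj n) 1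
  map : ∀ {m n : ℕ}, (Fin m ↪ Fin n) → (obj m →* obj n)
  map_continuous : ∀ {m n : ℕ} (α : Fin m ↪ Fin n), Continuous (map α)
  map_id : ∀ {n : ℕ} (g : obj n), map (Function.Embedding.refl _) g = g
  map_comp : ∀ {l m n : ℕ} (α : Fin l ↪ Fin m) (β : Fin m ↪ Fin n) (g : obj l),
    map (α.trans β) g = map β (map α g)
  mu : ∀ {m n : ℕ}, obj m → obj n → obj (m + n)
  mu_continuous : ∀ m n : ℕ, KCont.{u} fun p : obj m × obj n => mu p.1 p.2
  mu_natural : ∀ {m n m' n' : ℕ} (α : Fin m ↪ Fin m') (β : Fin n ↪ Fin n') (g : obj m)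
    (h : obj n), mu (map α g) (map β h) = map (addEmb α β) (mu g h)
  mu_assoc : ∀ {l m n : ℕ} (g : obj l) (h : obj m) (k : obj n),
    map (castEmb (Nat.add_assoc l m n)) (mu (mu g h) k) = mu g (mu h k)
  one_mu : ∀ {n : ℕ} (g : obj n), map (castEmb (Nat.zero_add n)) (mu (1 : obj 0) g) = g
  mu_one : ∀ {n : ℕ} (g : obj n), map (castEmb (Nat.add_zero n)) (mu g (1 : obj 0)) = g
  interchange : ∀ {m n : ℕ} (g g' : obj m) (h h' : obj n),
    mu (g * g') (h * h') = mu g h * mu g' h'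

attribute [instance] EHIGroup.top EHIGroup.cg EHIGroup.t2 EHIGroup.grp

namespace EHIGroup

variable (G : EHIGroup.{u})

/-- The underlying `𝓘`-monoid of an EH-`𝓘`-group, with multiplication `μ`. -/
def toIMonoid : IMonoid.{u} where
  obj := G.obj
  top := G.top
  cg := G.cg
  t2 := G.t2
  pt _ := 1
  map α := G.map α
  map_continuous := G.map_continuous
  map_pt _ := map_one _
  map_id := G.map_id
  map_comp := G.map_comp
  mul := G.mu
  mul_continuous := G.mu_continuous
  mul_natural := G.mu_natural
  mul_assoc := G.mu_assoc
  one_mul := G.one_mu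
  mul_one := G.mu_one

theorem mu_one_left {m n : ℕ} (h : G.obj n) :
    G.mu (1 : G.obj m) h = G.map (Fin.natAddEmb m) h := by
  refine (G.toIMonoid.mul_eq_mulE (1 : G.obj m) h).trans
    ((G.toIMonoid.mulE_pt_left _ h).trans ?_)
  refine DFunLike.congr_fun (congrArg _ ?_) h
  ext i; simp

theorem mu_one_right {m n : ℕ} (g : G.obj m) :
    G.mu g (1 : G.obj n) = G.map (Fin.castAddEmb n) g := by
  refine (G.toIMonoid.mul_eq_mulE g (1 : G.obj n)).trans
    ((G.toIMonoid.mulE_pt_right _ g).trans ?_)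
  refine DFunLike.congr_fun (congrArg _ ?_) g
  ext i; simp

/-- The Eckmann–Hilton argument: the `𝓘`-monoid structure is commutative. -/
theorem mu_comm {m n : ℕ} (g : G.obj m) (h : G.obj n) :
    G.map (flipEmb m n) (G.mu g h) = G.mu h g := by
  have h1 : G.mu g h = G.map (Fin.castAddEmb n) g * G.map (Fin.natAddEmb m) h := by
    rw [← mu_one_left, ← mu_one_right, ← G.interchange, mul_one, one_mul]
  have h2 : G.mu h g = G.map (Fin.natAddEmb n) g * G.map (Fin.castAddEmb m) h := by
    rw [← mu_one_left, ← mu_one_right, ← G.interchange, mul_one, one_mul]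
  rw [h1, h2, map_mul, ← G.map_comp, ← G.map_comp]
  congr 1
  · refine DFunLike.congr_fun (congrArg _ ?_) g
    ext i; simp [flipEmb]
  · refine DFunLike.congr_fun (congrArg _ ?_) h
    ext i; simp [flipEmb]

/-- The underlying commutative `𝓘`-monoid of an EH-`𝓘`-group. -/
def toCommIMonoid : CommIMonoid.{u} where
  toIMonoid := G.toIMonoid
  mul_comm := G.mu_comm

/-- `G` has compatible inverses: the two stabilisations of `g ∈ G(m)` to `G(m ⊔ m)`, along
`ι_m ⊔ id` and `id ⊔ ι_m`, are connected by a path. -/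
def CompatibleInverses : Prop :=
  ∀ (m : ℕ) (g : G.obj m), Joined (G.map (Fin.natAddEmb m) g) (G.map (Fin.castAddEmb m) g)

end EHIGroup

end EHI

namespace EHI

/-! ### Commutative symmetric ring spectra and the `𝓘`-monoid `Ω^∞(R)` -/

/-- The block sum of two bijections. -/
def addEquiv {m n m' n' : ℕ} (σ : Fin m ≃ Fin m') (τ : Fin n ≃ Fin n') :
    Fin (m + n) ≃ Fin (m' + n') :=
  finSumFinEquiv.symm.trans ((σ.sumCongr τ).trans finSumFinEquiv)

/-- A commutative symmetric ring spectrum (of compactly generated Hausdorff spaces).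
The actions of the symmetric groups are given as one functor on the groupoid of the sets
`{1, …, n}` and all bijections; as there are no bijections for `m ≠ n`, this is the same as a
`Σ_n`-action on `R_n` for every `n`, and allows to identify e.g. `R_{(l+m)+n}` with `R_{l+(m+n)}`.
A map out of a smash product is a map out of the compactly generated product which sends the wedge
to the base point. The sphere `S^n` is `I^n / ∂I^n` with permutation of the coordinates (`S^0`
consists of two points), so that a pointed map `S^n → Y` is a map `I^n → Y` sending `∂I^n` to the
base point, i.e. an element of `GenLoop (Fin n) Y y₀`. -/
structure CommSymRingSpectrum where
  obj : ℕ → Type u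
  top : ∀ n, TopologicalSpace (obj n)
  cg : ∀ n, CompactlyGeneratedSpace (obj n)
  t2 : ∀ n, T2Space (obj n)
  pt : ∀ n, obj n
  act : ∀ {m n : ℕ}, (Fin m ≃ Fin n) → obj m → obj n
  act_continuous : ∀ {m n : ℕ} (σ : Fin m ≃ Fin n), Continuous (act σ)
  act_pt : ∀ {m n : ℕ} (σ : Fin m ≃ Fin n), act σ (pt m) = pt n
  act_refl : ∀ {n : ℕ} (x : obj n), act (Equiv.refl _) x = x
  act_trans : ∀ {l m n : ℕ} (σ : Fin l ≃ Fin m) (τ : Fin m ≃ Fin n) (x : obj l),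
    act (σ.trans τ) x = act τ (act σ x)
  mu : ∀ {m n : ℕ}, obj m → obj n → obj (m + n)
  mu_continuous : ∀ m n : ℕ, KCont.{u} fun p : obj m × obj n => mu p.1 p.2
  pt_mu : ∀ {m n : ℕ} (y : obj n), mu (pt m) y = pt (m + n)
  mu_pt : ∀ {m n : ℕ} (x : obj m), mu x (pt n) = pt (m + n)
  mu_act : ∀ {m n m' n' : ℕ} (σ : Fin m ≃ Fin m') (τ : Fin n ≃ Fin n') (x : obj m) (y : obj n),
    mu (act σ x) (act τ y) = act (addEquiv σ τ) (mu x y)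
  eta : ∀ n, GenLoop (Fin n) (obj n) (pt n)
  eta_equivariant : ∀ {m n : ℕ} (σ : Fin m ≃ Fin n) (t : Fin m → unitInterval),
    act σ (eta m t) = eta n (t ∘ σ.symm)
  mu_assoc : ∀ {l m n : ℕ} (x : obj l) (y : obj m) (z : obj n),
    act (finCongr (Nat.add_assoc l m n)) (mu (mu x y) z) = mu x (mu y z)
  mu_eta : ∀ {m n : ℕ} (s : Fin m → unitInterval) (t : Fin n → unitInterval),
    mu (eta m s) (eta n t) = eta (m + n) (Fin.append s t)
  eta_mu : ∀ {n : ℕ} (t : Fin 0 → unitInterval) (x : obj n),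
    act (finCongr (Nat.zero_add n)) (mu (eta 0 t) x) = x
  mu_comm : ∀ {m n : ℕ} (x : obj m) (y : obj n), act finAddFlip (mu x y) = mu y x

attribute [instance] CommSymRingSpectrum.top CommSymRingSpectrum.cg CommSymRingSpectrum.t2

/-- For an injective map `α : m → n` with `l = n - m`, the bijection `ᾱ : l ⊔ m → n` which is
order preserving on the first `l` elements and given by `α` on the last `m` elements. -/
noncomputable def barEquiv {m n : ℕ} (α : Fin m ↪ Fin n) : Fin (n - m + m) ≃ Fin n :=
  finSumFinEquiv.symm.trans (Equiv.ofBijective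
    (Sum.elim ((Finset.univ.map α)ᶜ.orderEmbOfFin (k := n - m) (by simp [Finset.card_compl])) α)
    (by
      have hmn : m ≤ n := by simpa using Fintype.card_le_of_embedding α
      rw [Fintype.bijective_iff_injective_and_card]
      refine ⟨Function.Injective.sumElim (RelEmbedding.injective _) α.injective fun i j h => ?_,
        by simp; omega⟩
      have := Finset.orderEmbOfFin_mem (Finset.univ.map α)ᶜ (k := n - m)
        (by simp [Finset.card_compl]) i
      rw [h] at this
      simp at this))

theorem barEquiv_natAdd {m n : ℕ} (α : Fin m ↪ Fin n) (i : Fin m) :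
    barEquiv α (Fin.natAdd (n - m) i) = α i := by
  simp [barEquiv]

/-- Auxiliary algebraic structure: a commutative monoid in symmetric sequences of sets with a
compatible family of central elements. -/
structure SeqMon where
  obj : ℕ → Type u
  act : ∀ {m n : ℕ}, (Fin m ≃ Fin n) → obj m → obj n
  act_refl : ∀ {n : ℕ} (x : obj n), act (Equiv.refl _) x = x
  act_trans : ∀ {l m n : ℕ} (σ : Fin l ≃ Fin m) (τ : Fin m ≃ Fin n) (x : obj l),
    act (σ.trans τ) x = act τ (act σ x)
  mul : ∀ {m n : ℕ}, obj m → obj n → obj (m + n)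
  mul_act : ∀ {m n m' n' : ℕ} (σ : Fin m ≃ Fin m') (τ : Fin n ≃ Fin n') (x : obj m) (y : obj n),
    mul (act σ x) (act τ y) = act (addEquiv σ τ) (mul x y)
  mul_assoc : ∀ {l m n : ℕ} (x : obj l) (y : obj m) (z : obj n),
    act (finCongr (Nat.add_assoc l m n)) (mul (mul x y) z) = mul x (mul y z)
  mul_comm : ∀ {m n : ℕ} (x : obj m) (y : obj n), act finAddFlip (mul x y) = mul y x
  eta : ∀ n, obj n
  act_eta : ∀ {m n : ℕ} (σ : Fin m ≃ Fin n), act σ (eta m) = eta n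
  mul_eta : ∀ m n : ℕ, mul (eta m) (eta n) = eta (m + n)
  eta_mul : ∀ {n : ℕ} (x : obj n), act (finCongr (Nat.zero_add n)) (mul (eta 0) x) = x

namespace SeqMon

variable (P : SeqMon.{u})

/-- The product transported along a bijection. -/
def mulE {m n N : ℕ} (e : Fin m ⊕ Fin n ≃ Fin N) (x : P.obj m) (y : P.obj n) : P.obj N :=
  P.act (finSumFinEquiv.symm.trans e) (P.mul x y)

theorem act_mul {m n N : ℕ} (f : Fin (m + n) ≃ Fin N) (x : P.obj m) (y : P.obj n) :
    P.act f (P.mul x y) = P.mulE (finSumFinEquiv.trans f) x y := by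
  rw [mulE]; congr 1; ext i; simp

theorem mul_eq_mulE {m n : ℕ} (x : P.obj m) (y : P.obj n) :
    P.mul x y = P.mulE finSumFinEquiv x y := by
  rw [mulE, Equiv.symm_trans_self, P.act_refl]

theorem act_mulE {m n N N' : ℕ} (e : Fin m ⊕ Fin n ≃ Fin N) (f : Fin N ≃ Fin N') (x : P.obj m)
    (y : P.obj n) : P.act f (P.mulE e x y) = P.mulE (e.trans f) x y := by
  rw [mulE, mulE, ← P.act_trans]; rfl

theorem mulE_act_left {m n m' N : ℕ} (e : Fin m' ⊕ Fin n ≃ Fin N) (f : Fin m ≃ Fin m')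
    (x : P.obj m) (y : P.obj n) :
    P.mulE e (P.act f x) y = P.mulE ((f.sumCongr (.refl _)).trans e) x y := by
  conv_lhs => rw [← P.act_refl y]
  rw [mulE, P.mul_act, ← P.act_trans, mulE]
  congr 1
  ext i
  simp [addEquiv]

theorem mulE_comm {m n N : ℕ} (e : Fin m ⊕ Fin n ≃ Fin N) (x : P.obj m) (y : P.obj n) :
    P.mulE e x y = P.mulE ((Equiv.sumComm _ _).trans e) y x := by
  rw [mulE, mulE, ← P.mul_comm x y, ← P.act_trans]
  congr 1
  ext i
  obtain ⟨i, rfl⟩ := finSumFinEquiv.surjective i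
  rcases i with i | i <;> simp [-finSumFinEquiv_apply_left, -finSumFinEquiv_apply_right, finAddFlip]

theorem mulE_act_right {m n n' N : ℕ} (e : Fin m ⊕ Fin n' ≃ Fin N) (g : Fin n ≃ Fin n')
    (x : P.obj m) (y : P.obj n) :
    P.mulE e x (P.act g y) = P.mulE ((Equiv.sumCongr (.refl _) g).trans e) x y := by
  conv_lhs => rw [← P.act_refl x]
  rw [mulE, P.mul_act, ← P.act_trans, mulE]
  congr 1
  ext i
  simp [addEquiv]

theorem mulE_assoc {l m n a b N : ℕ} (e : Fin a ⊕ Fin n ≃ Fin N) (f : Fin l ⊕ Fin m ≃ Fin a)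
    (e' : Fin l ⊕ Fin b ≃ Fin N) (f' : Fin m ⊕ Fin n ≃ Fin b)
    (h₁ : ∀ i, e (Sum.inl (f (Sum.inl i))) = e' (Sum.inl i))
    (h₂ : ∀ i, e (Sum.inl (f (Sum.inr i))) = e' (Sum.inr (f' (Sum.inl i))))
    (h₃ : ∀ i, e (Sum.inr i) = e' (Sum.inr (f' (Sum.inr i))))
    (x : P.obj l) (y : P.obj m) (z : P.obj n) :
    P.mulE e (P.mulE f x y) z = P.mulE e' x (P.mulE f' y z) := by
  rw [show P.mulE f x y = P.act _ (P.mul x y) from rfl,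
    show P.mulE f' y z = P.act _ (P.mul y z) from rfl, mulE_act_left, mulE_act_right]
  rw [mulE, mulE, ← P.mul_assoc, ← P.act_trans]
  congr 1
  ext i
  obtain ⟨i, rfl⟩ := finSumFinEquiv.surjective i
  rcases i with i | i
  · obtain ⟨i, rfl⟩ := finSumFinEquiv.surjective i
    rcases i with i | i
    · have : finCongr (Nat.add_assoc l m n) (finSumFinEquiv (Sum.inl (finSumFinEquiv (Sum.inl i))))
          = finSumFinEquiv (Sum.inl i) := by ext; simp
      simp only [Equiv.trans_apply, this, Equiv.symm_apply_apply]
      simp [h₁, -finSumFinEquiv_apply_left, -finSumFinEquiv_apply_right]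
    · have : finCongr (Nat.add_assoc l m n) (finSumFinEquiv (Sum.inl (finSumFinEquiv (Sum.inr i))))
          = finSumFinEquiv (Sum.inr (finSumFinEquiv (Sum.inl i))) := by ext; simp
      simp only [Equiv.trans_apply, this, Equiv.symm_apply_apply]
      simp [h₂, -finSumFinEquiv_apply_left, -finSumFinEquiv_apply_right]
  · have : finCongr (Nat.add_assoc l m n) (finSumFinEquiv (Sum.inr i))
        = finSumFinEquiv (Sum.inr (finSumFinEquiv (Sum.inr i))) := by
      ext; simp [Nat.add_assoc]
    simp only [Equiv.trans_apply, this, Equiv.symm_apply_apply]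
    simp [h₃, -finSumFinEquiv_apply_left, -finSumFinEquiv_apply_right]

/-- Re-bracketing to the right, with the resulting bijection. -/
theorem mulE_assoc_right {l m n a b N : ℕ} (e : Fin a ⊕ Fin n ≃ Fin N)
    (f : Fin l ⊕ Fin m ≃ Fin a) (g : Fin m ⊕ Fin n ≃ Fin b)
    (x : P.obj l) (y : P.obj m) (z : P.obj n) :
    P.mulE e (P.mulE f x y) z = P.mulE ((Equiv.sumCongr (.refl _) g.symm).trans
      ((Equiv.sumAssoc _ _ _).symm.trans ((f.sumCongr (.refl _)).trans e))) x (P.mulE g y z) := by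
  refine P.mulE_assoc _ _ _ _ ?_ ?_ ?_ _ _ _ <;> intro i <;> simp

/-- Re-bracketing to the left, with the resulting bijection. -/
theorem mulE_assoc_left {l m n a b N : ℕ} (e : Fin l ⊕ Fin b ≃ Fin N)
    (g : Fin m ⊕ Fin n ≃ Fin b) (f : Fin l ⊕ Fin m ≃ Fin a)
    (x : P.obj l) (y : P.obj m) (z : P.obj n) :
    P.mulE e x (P.mulE g y z) = P.mulE ((Equiv.sumCongr f.symm (.refl _)).trans
      ((Equiv.sumAssoc _ _ _).trans ((Equiv.sumCongr (.refl _) g).trans e))) (P.mulE f x y) z := by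
  refine (P.mulE_assoc _ _ _ _ ?_ ?_ ?_ _ _ _).symm <;> intro i <;> simp

theorem mulE_interchange {p q r s a b c d N : ℕ} (e : Fin a ⊕ Fin b ≃ Fin N)
    (f : Fin p ⊕ Fin q ≃ Fin a) (g : Fin r ⊕ Fin s ≃ Fin b) (f' : Fin p ⊕ Fin r ≃ Fin c)
    (g' : Fin q ⊕ Fin s ≃ Fin d) (x : P.obj p) (y : P.obj q) (z : P.obj r) (w : P.obj s) :
    P.mulE e (P.mulE f x y) (P.mulE g z w) = P.mulE ((f'.symm.sumCongr g'.symm).trans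
      ((Equiv.sumSumSumComm _ _ _ _).trans ((f.sumCongr g).trans e)))
      (P.mulE f' x z) (P.mulE g' y w) := by
  rw [P.mulE_assoc_right e f finSumFinEquiv, P.mulE_assoc_left _ g finSumFinEquiv,
    P.mulE_comm finSumFinEquiv y z, P.mulE_assoc_right _ _ g', P.mulE_assoc_left _ _ f']
  congr 1
  ext i
  rcases i with i | i
  · obtain ⟨i, rfl⟩ := f'.surjective i
    rcases i with i | i <;> simp
  · obtain ⟨i, rfl⟩ := g'.surjective i
    rcases i with i | i <;> simp

theorem mulE_eta_congr {l l' m n : ℕ} (e : Fin l ⊕ Fin m ≃ Fin n) (e' : Fin l' ⊕ Fin m ≃ Fin n)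
    (h : ∀ i, e (Sum.inr i) = e' (Sum.inr i)) (x : P.obj m) :
    P.mulE e (P.eta l) x = P.mulE e' (P.eta l') x := by
  have hs : ∀ i : Fin l', ∃ j : Fin l, e (Sum.inl j) = e' (Sum.inl i) := by
    intro i
    obtain ⟨k, hk⟩ := e.surjective (e' (Sum.inl i))
    rcases k with k | k
    · exact ⟨k, hk⟩
    · rw [h] at hk; exact absurd (e'.injective hk) (by simp)
  choose s hs using hs
  have hinj : Function.Injective s := fun i j hij => by
    have : e' (Sum.inl i) = e' (Sum.inl j) := by rw [← hs, ← hs, hij]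
    simpa using this
  have hcard : l' = l := by
    have h1 := Fintype.card_congr e
    have h2 := Fintype.card_congr e'
    simp at h1 h2; omega
  let σ : Fin l' ≃ Fin l := Equiv.ofBijective s
    ((Fintype.bijective_iff_injective_and_card s).2 ⟨hinj, by simp [hcard]⟩)
  rw [← P.act_eta σ, mulE_act_left]
  congr 1
  ext i
  rcases i with i | i
  · simp [σ, hs]
  · simp [h]

theorem eta_mulE {n N : ℕ} (e : Fin 0 ⊕ Fin n ≃ Fin N) (x : P.obj n) :
    P.mulE e (P.eta 0) x = P.act ((Equiv.emptySum _ _).symm.trans e) x := by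
  conv_rhs => rw [← P.eta_mul x]
  rw [act_mul, act_mulE]
  congr 1
  ext i
  rcases i with i | i
  · exact i.elim0
  · have : (finCongr (Nat.zero_add n)) (finSumFinEquiv (m := 0) (Sum.inr i)) = i := by
      ext; simp
    simp only [Equiv.trans_apply, this]
    rfl

/-- The functoriality in injective maps: `α_* f = ᾱ (η_l · f)`. -/
noncomputable def map {m n : ℕ} (α : Fin m ↪ Fin n) (f : P.obj m) : P.obj n :=
  P.act (barEquiv α) (P.mul (P.eta (n - m)) f)

theorem map_eq {l m n : ℕ} (α : Fin m ↪ Fin n) (e : Fin l ⊕ Fin m ≃ Fin n)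
    (h : ∀ i, e (Sum.inr i) = α i) (f : P.obj m) : P.map α f = P.mulE e (P.eta l) f := by
  rw [map, act_mul]
  exact P.mulE_eta_congr _ _ (fun i => by simp [h, barEquiv_natAdd]) f

theorem map_equiv {m n : ℕ} (σ : Fin m ≃ Fin n) (f : P.obj m) :
    P.map σ.toEmbedding f = P.act σ f := by
  rw [P.map_eq σ.toEmbedding ((Equiv.emptySum (Fin 0) _).trans σ) (fun i => by simp), eta_mulE]
  congr 1

theorem map_eta {m n : ℕ} (α : Fin m ↪ Fin n) : P.map α (P.eta m) = P.eta n := by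
  rw [map, P.mul_eta, P.act_eta]

theorem map_id {n : ℕ} (f : P.obj n) : P.map (Function.Embedding.refl _) f = f :=
  (P.map_equiv (Equiv.refl _) f).trans (P.act_refl f)

theorem map_comp {l m n : ℕ} (α : Fin l ↪ Fin m) (β : Fin m ↪ Fin n) (f : P.obj l) :
    P.map (α.trans β) f = P.map β (P.map α f) := by
  rw [P.map_eq β (finSumFinEquiv.trans (barEquiv β)) (fun i => by simp [barEquiv_natAdd]),
    P.map_eq α (finSumFinEquiv.trans (barEquiv α)) (fun i => by simp [barEquiv_natAdd]),
    P.mulE_assoc_left _ _ finSumFinEquiv, ← P.mul_eq_mulE, P.mul_eta]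
  refine P.map_eq _ _ (fun i => ?_) f
  simp [barEquiv_natAdd]

theorem mul_natural {m n m' n' : ℕ} (α : Fin m ↪ Fin m') (β : Fin n ↪ Fin n') (x : P.obj m)
    (y : P.obj n) : P.mul (P.map α x) (P.map β y) = P.map (addEmb α β) (P.mul x y) := by
  rw [P.map_eq α (finSumFinEquiv.trans (barEquiv α)) (fun i => by simp [barEquiv_natAdd]),
    P.map_eq β (finSumFinEquiv.trans (barEquiv β)) (fun i => by simp [barEquiv_natAdd]),
    mul_eq_mulE, P.mulE_interchange _ _ _ finSumFinEquiv finSumFinEquiv, ← P.mul_eq_mulE,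
    ← P.mul_eq_mulE, P.mul_eta]
  symm
  refine P.map_eq _ _ (fun i => ?_) _
  obtain ⟨i, rfl⟩ := finSumFinEquiv.surjective i
  rcases i with i | i <;> simp [addEmb, barEquiv_natAdd]

theorem one_mul {n : ℕ} (x : P.obj n) :
    P.map (castEmb (Nat.zero_add n)) (P.mul (P.eta 0) x) = x :=
  (P.map_equiv _ _).trans (P.eta_mul x)

theorem mul_one {n : ℕ} (x : P.obj n) :
    P.map (castEmb (Nat.add_zero n)) (P.mul x (P.eta 0)) = x := by
  refine (P.map_equiv _ _).trans ?_
  rw [act_mul, mulE_comm, eta_mulE]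
  refine Eq.trans ?_ (P.act_refl x)
  congr 1
  ext i
  simp [-finSumFinEquiv_apply_left, -finSumFinEquiv_apply_right, finSumFinEquiv]

end SeqMon

end EHI

namespace EHI

namespace CommSymRingSpectrum

variable (R : CommSymRingSpectrum.{u})

/-- The set `Ω^n(R_n)` of pointed maps `S^n → R_n`. -/
abbrev Loops (n : ℕ) : Type u := GenLoop (Fin n) (R.obj n) (R.pt n)

variable {R}

/-- The conjugation `σ ∘ f ∘ σ⁻¹` of a pointed map `f : S^m → R_m`. -/
def loopAct {m n : ℕ} (σ : Fin m ≃ Fin n) (f : R.Loops m) : R.Loops n :=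
  ⟨⟨fun t => R.act σ (f (t ∘ σ)),
    (R.act_continuous σ).comp (f.1.continuous.comp (by fun_prop))⟩, by
    rintro t ⟨i, hi⟩
    have h : f (t ∘ σ) = R.pt m := f.2 _ ⟨σ.symm i, by simpa using hi⟩
    exact (congrArg _ h).trans (R.act_pt σ)⟩

/-- The map `S^{m+n} = S^m ∧ S^n → R_m ∧ R_n → R_{m+n}` obtained from `f` and `g`. -/
def loopMul {m n : ℕ} (f : R.Loops m) (g : R.Loops n) : R.Loops (m + n) :=
  ⟨⟨fun t => R.mu (f fun i => t (Fin.castAdd n i)) (g fun i => t (Fin.natAdd m i)),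
    kcont_comp (R.mu_continuous m n)
      (g := fun t : Fin (m + n) → unitInterval =>
        (f fun i => t (Fin.castAdd n i), g fun i => t (Fin.natAdd m i)))
      ((f.1.continuous.comp (by fun_prop)).prodMk (g.1.continuous.comp (by fun_prop)))⟩, by
    rintro t ⟨i, hi⟩
    induction i using Fin.addCases with
    | left i =>
      have h : f (fun i => t (Fin.castAdd n i)) = R.pt m := f.2 _ ⟨i, hi⟩
      exact (congrArg (fun z => R.mu z _) h).trans (R.pt_mu _)
    | right i =>
      have h : g (fun i => t (Fin.natAdd m i)) = R.pt n := g.2 _ ⟨i, hi⟩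
      exact (congrArg (R.mu _) h).trans (R.mu_pt _)⟩

theorem loopAct_apply {m n : ℕ} (σ : Fin m ≃ Fin n) (f : R.Loops m) (t : Fin n → unitInterval) :
    loopAct σ f t = R.act σ (f (t ∘ σ)) := rfl

theorem loopMul_apply {m n : ℕ} (f : R.Loops m) (g : R.Loops n) (t : Fin (m + n) → unitInterval) :
    loopMul f g t = R.mu (f fun i => t (Fin.castAdd n i)) (g fun i => t (Fin.natAdd m i)) := rfl

variable (R)

/-- The algebraic structure on the sets `Ω^n(R_n)`. -/
def loopsSeq : SeqMon.{u} where
  obj := R.Loops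
  act := loopAct
  act_refl f := GenLoop.ext _ _ fun t => R.act_refl _
  act_trans σ τ f := GenLoop.ext _ _ fun t => R.act_trans σ τ _
  mul := loopMul
  mul_act σ τ f g := GenLoop.ext _ _ fun t => by
    simp only [loopMul_apply, loopAct_apply, R.mu_act]
    congr 3 <;> funext i <;> simp [addEquiv]
  mul_assoc f g h := GenLoop.ext _ _ fun t => by
    simp only [loopMul_apply, loopAct_apply, ← R.mu_assoc]
    congr 4 <;> funext i <;> simp <;> congr 1 <;> ext <;> simp [Nat.add_assoc]
  mul_comm f g := GenLoop.ext _ _ fun t => by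
    simp only [loopMul_apply, loopAct_apply, ← R.mu_comm (f _) (g _)]
    congr 3 <;> funext i <;> simp
  eta := R.eta
  act_eta σ := GenLoop.ext _ _ fun t => by
    rw [loopAct_apply, R.eta_equivariant]
    congr 1
    funext i
    simp
  mul_eta m n := GenLoop.ext _ _ fun t => by
    rw [loopMul_apply, R.mu_eta]
    congr 1
    exact Fin.append_castAdd_natAdd
  eta_mul f := GenLoop.ext _ _ fun t => by
    rw [loopAct_apply, loopMul_apply]
    refine (R.eta_mu _ _).trans (congrArg _ ?_)
    funext i
    simp only [Function.comp]
    congr 1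
    ext
    simp

variable {R}

theorem continuous_loops {K : Type u} [TopologicalSpace K] {n : ℕ} (F : K → R.Loops n)
    (h : Continuous fun p : K × (Fin n → unitInterval) => F p.1 p.2) : Continuous F :=
  (ContinuousMap.continuous_of_continuous_uncurry (fun k => (F k).1) h).subtype_mk _

theorem loopAct_continuous {m n : ℕ} (σ : Fin m ≃ Fin n) :
    Continuous (loopAct (R := R) σ) := by
  refine (ContinuousMap.continuous_of_continuous_uncurry _ ?_).subtype_mk _
  refine (R.act_continuous σ).comp ?_
  change Continuous fun p : R.Loops m × (Fin n → unitInterval) => p.1 (p.2 ∘ σ)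
  exact continuous_eval.comp (continuous_fst.prodMk (by fun_prop))

theorem loopMul_kcont (m n : ℕ) :
    KCont.{u} fun p : R.Loops m × R.Loops n => loopMul p.1 p.2 := by
  refine (kcont_iff _).2 fun K _ _ _ g hg => continuous_loops _ ?_
  refine (kcont_iff _).1 (R.mu_continuous m n) (K × (Fin (m + n) → unitInterval))
    (fun p => ((g p.1).1 fun i => p.2 (Fin.castAdd n i), (g p.1).2 fun i => p.2 (Fin.natAdd m i)))
    (Continuous.prodMk ?_ ?_)
  · exact continuous_eval.comp ((by fun_prop : Continuous fun p : K × (Fin (m + n) → unitInterval)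
      => (g p.1).1).prodMk (by fun_prop))
  · exact continuous_eval.comp ((by fun_prop : Continuous fun p : K × (Fin (m + n) → unitInterval)
      => (g p.1).2).prodMk (by fun_prop))

variable (R)

/-- The commutative `𝓘`-monoid `Ω^∞(R)`, with `Ω^∞(R)(n) = Ω^n(R_n)`, base points `η_n`,
functoriality `α_* f = ᾱ ∘ μ(η_l ∧ f) ∘ ᾱ⁻¹` and multiplication `μ(f ∧ g)`. -/
noncomputable def Omega : CommIMonoid.{u} where
  obj := R.Loops
  top n := kTop (R.Loops n) inferInstance
  cg n := kTop_cg _ _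
  t2 n := kTop_t2 _ _ inferInstance
  pt := R.eta
  map α f := loopAct (barEquiv α) (loopMul (R.eta _) f)
  map_continuous {m n} α := (kTop_continuous_kTop_iff _ _ _).2 (by
    refine (loopAct_continuous (barEquiv α)).continuousGeneratedBy.comp ?_
    refine (kcont_iff _).2 fun K _ _ _ g hg => ?_
    exact (kcont_iff _).1 (loopMul_kcont (R := R) (n - m) m) K (fun k => (R.eta (n - m), g k))
      (by fun_prop))
  map_pt := R.loopsSeq.map_eta
  map_id := R.loopsSeq.map_id
  map_comp := R.loopsSeq.map_comp
  mul := loopMul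
  mul_continuous m n := (kcont_kTop_iff _ _ _).2 (kcont_kTop_prod (loopMul_kcont m n))
  mul_natural := R.loopsSeq.mul_natural
  mul_assoc f g h := (R.loopsSeq.map_equiv _ _).trans (R.loopsSeq.mul_assoc f g h)
  one_mul := R.loopsSeq.one_mul
  mul_one := R.loopsSeq.mul_one
  mul_comm f g := (R.loopsSeq.map_equiv _ _).trans (R.loopsSeq.mul_comm f g)

/-- An element of `Ω^∞(R)(n)`, regarded as a pointed map `S^n → R_n`. -/
def toLoop {R : CommSymRingSpectrum.{u}} {n : ℕ} (f : R.Omega.obj n) : R.Loops n := f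

/-- The commutative `𝓘`-monoid `gl_1(R)` of units of `R`. -/
noncomputable def gl1 : CommIMonoid.{u} := R.Omega.units

end CommSymRingSpectrum

/-- An action of an EH-`𝓘`-group `G` on a commutative symmetric ring spectrum `R`. -/
structure EHIAction (G : EHIGroup.{u}) (R : CommSymRingSpectrum.{u}) where
  κ : ∀ n, G.obj n → R.obj n → R.obj n
  continuous : ∀ n, KCont.{u} fun p : G.obj n × R.obj n => κ n p.1 p.2
  one_act : ∀ n (x : R.obj n), κ n 1 x = x
  mul_act : ∀ n (g h : G.obj n) (x : R.obj n), κ n (g * h) x = κ n g (κ n h x)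
  act_pt : ∀ n (g : G.obj n), κ n g (R.pt n) = R.pt n
  equivariant : ∀ n (σ : Equiv.Perm (Fin n)) (g : G.obj n) (x : R.obj n),
    κ n (G.map σ.toEmbedding g) (R.act σ x) = R.act σ (κ n g x)
  zero_act : ∀ (g : G.obj 0) (x : R.obj 0), κ 0 g x = x
  mu_act : ∀ m n (g : G.obj m) (h : G.obj n) (x : R.obj m) (y : R.obj n),
    κ (m + n) (G.mu g h) (R.mu x y) = R.mu (κ m g x) (κ n h y)
  stabilization : ∀ l m (g : G.obj m) (s : Fin l → unitInterval) (x : R.obj m),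
    κ (l + m) (G.map (Fin.natAddEmb l) g) (R.mu (R.eta l s) x) = R.mu (R.eta l s) (κ m g x)

end EHI

namespace EHI

/-! ### Geometric realization and homotopy colimits -/

/-- The topological standard `n`-simplex. -/
abbrev Simp (n : SimplexCategory) : Type := stdSimplex ℝ (Fin (n.len + 1))

/-- The disjoint union of the spaces `Y_n × Δ^n`. -/
abbrev PreReal (Y : SimplicialObject TopCat.{u}) : Type u :=
  Σ n : SimplexCategory, Y.obj (op n) × Simp n

/-- The relation `(f^* y, t) ∼ (y, f_* t)` for morphisms `f` in the simplex category. -/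
inductive RealRel (Y : SimplicialObject TopCat.{u}) : PreReal Y → PreReal Y → Prop
  | mk {m n : SimplexCategory} (f : m ⟶ n) (y : Y.obj (op n)) (t : Simp m) :
    RealRel Y ⟨m, Y.map f.op y, t⟩ ⟨n, y, stdSimplex.map f.toOrderHom t⟩

/-- The geometric realization of a simplicial space, with the quotient topology. -/
abbrev GReal (Y : SimplicialObject TopCat.{u}) : Type u := Quot (RealRel Y)

/-- The point of the realization represented by `(y, t) ∈ Y_n × Δ^n`. -/
def GReal.mk {Y : SimplicialObject TopCat.{u}} (n : SimplexCategory) (y : Y.obj (op n))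
    (t : Simp n) : GReal Y := Quot.mk _ ⟨n, y, t⟩

/-- The map of realizations induced by a map of simplicial spaces. -/
def GReal.map {Y Z : SimplicialObject TopCat.{u}} (φ : Y ⟶ Z) : GReal Y → GReal Z :=
  Quot.map (fun p => ⟨p.1, φ.app (op p.1) p.2.1, p.2.2⟩) (by
    rintro _ _ ⟨f, y, t⟩
    have h : φ.app _ (Y.map f.op y) = Z.map f.op (φ.app _ y) := NatTrans.naturality_apply φ f.op y
    simp only [h]
    exact RealRel.mk f _ t)

theorem GReal.map_mk {Y Z : SimplicialObject TopCat.{u}} (φ : Y ⟶ Z) (n : SimplexCategory)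
    (y : Y.obj (op n)) (t : Simp n) :
    GReal.map φ (GReal.mk n y t) = GReal.mk n (φ.app (op n) y) t := rfl

theorem GReal.map_continuous {Y Z : SimplicialObject TopCat.{u}} (φ : Y ⟶ Z) :
    Continuous (GReal.map φ) := by
  refine continuous_quot_lift _ (continuous_quot_mk.comp (continuous_sigma fun n => ?_))
  exact continuous_sigmaMk.comp (((φ.app (op n)).hom.continuous.comp continuous_fst).prodMk
    continuous_snd)

/-- Geometric realization, as a functor. -/
def realization : SimplicialObject TopCat.{u} ⥤ TopCat.{u} where
  obj Y := TopCat.of (GReal Y)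
  map φ := TopCat.ofHom ⟨GReal.map φ, GReal.map_continuous φ⟩
  map_id Y := by
    ext x
    induction x using Quot.ind
    rfl
  map_comp φ ψ := by
    ext x
    induction x using Quot.ind
    rfl

theorem chain_map_trans {J : Type} [SmallCategory J] (F : J ⥤ TopCat.{u}) {P : Type} [Preorder P]
    (c : P ⥤ J) {i j k : P} (h : i ≤ j) (h' : j ≤ k) (x : F.obj (c.obj i)) :
    F.map (c.map (homOfLE (h.trans h'))) x =
      F.map (c.map (homOfLE h')) (F.map (c.map (homOfLE h)) x) := by
  rw [← ConcreteCategory.comp_apply, ← F.map_comp, ← c.map_comp]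
  rfl

/-- The nerve of the transport category of a diagram of spaces `F : J ⥤ Top`: its space of
`p`-simplices is the disjoint union, over all chains `c₀ ⟶ ⋯ ⟶ c_p` in `J`, of the
spaces `F(c₀)`. -/
def srep {J : Type} [SmallCategory J] (F : J ⥤ TopCat.{u}) : SimplicialObject TopCat.{u} where
  obj p := TopCat.of (Σ c : Fin (p.unop.len + 1) ⥤ J, F.obj (c.obj 0))
  map {p q} f := TopCat.ofHom ⟨fun x => ⟨f.unop.toOrderHom.monotone.functor ⋙ x.1,
      F.map (x.1.map (homOfLE (Fin.zero_le (f.unop.toOrderHom 0)))) x.2⟩,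
    continuous_sigma fun c => (continuous_sigmaMk
      (σ := fun c : Fin (q.unop.len + 1) ⥤ J => F.obj (c.obj 0))
      (i := f.unop.toOrderHom.monotone.functor ⋙ c)).comp
      (F.map (c.map (homOfLE (Fin.zero_le (f.unop.toOrderHom 0))))).hom.continuous⟩
  map_id p := by
    refine TopCat.hom_ext (ContinuousMap.ext fun ⟨c, x⟩ => ?_)
    have : F.map (c.map (𝟙 0)) x = x := by
      rw [c.map_id, F.map_id]
      rfl
    exact congrArg (Sigma.mk (β := fun c : Fin (p.unop.len + 1) ⥤ J => F.obj (c.obj 0)) c) this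
  map_comp {p q r} f g := by
    refine TopCat.hom_ext (ContinuousMap.ext fun ⟨c, x⟩ => ?_)
    refine congrArg (Sigma.mk (β := fun c : Fin (r.unop.len + 1) ⥤ J => F.obj (c.obj 0)) _) ?_
    exact chain_map_trans F c _ _ x

/-- The map of nerves of transport categories induced by a functor `Φ : J ⥤ J'` and a natural
transformation from `F` to the restriction of `F'` along `Φ`. -/
def srepMap {J J' : Type} [SmallCategory J] [SmallCategory J'] {F : J ⥤ TopCat.{u}}
    {F' : J' ⥤ TopCat.{u}} (Φ : J ⥤ J') (η : F ⟶ Φ ⋙ F') : srep F ⟶ srep F' where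
  app p := TopCat.ofHom ⟨fun x => ⟨x.1 ⋙ Φ, η.app (x.1.obj 0) x.2⟩,
    continuous_sigma fun c => (continuous_sigmaMk
      (σ := fun c : Fin (p.unop.len + 1) ⥤ J' => F'.obj (c.obj 0)) (i := c ⋙ Φ)).comp
      (η.app (c.obj 0)).hom.continuous⟩
  naturality p q f := by
    refine TopCat.hom_ext (ContinuousMap.ext fun ⟨c, x⟩ => ?_)
    exact congrArg (Sigma.mk (β := fun c : Fin (q.unop.len + 1) ⥤ J' => F'.obj (c.obj 0)) _)
      (NatTrans.naturality_apply η _ x)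

/-- The homotopy colimit of a diagram of spaces. -/
abbrev hocolim {J : Type} [SmallCategory J] (F : J ⥤ TopCat.{u}) : TopCat.{u} :=
  realization.obj (srep F)

end EHI

namespace EHI

/-! ### `Γ`-spaces and the `Γ`-space of a commutative `𝓘`-monoid -/

/-- The category `Γ^op` of finite pointed sets. The object `A` stands for the finite pointed set
`S = A ⊔ {*}` (so that `A` is the complement `S̄` of the base point), and the pointed
maps `A ⊔ {*} → B ⊔ {*}` are given as maps `A → Option B`. -/
structure GammaOp where
  carrier : Type
  [fin : Finite carrier]

attribute [instance] GammaOp.fin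

instance : LargeCategory GammaOp where
  Hom A B := A.carrier → Option B.carrier
  id A := fun a => some a
  comp f g := fun a => (f a).bind g
  id_comp f := rfl
  comp_id f := funext fun a => Option.bind_fun_some _
  assoc f g h := funext fun a => Option.bind_assoc _ _ _

/-- An object of the category `D(S)`: a functor `θ` from the poset of subsets of `S̄` to `𝓘`, such
that for disjoint `U`, `V` the diagram `θ(U) → θ(U ∪ V) ← θ(V)` is a coproduct diagram of
finite sets. -/
structure DCat (A : Type) where
  fct : Set A ⥤ ICat
  coprod : ∀ U V : Set A, Disjoint U V → Function.Bijective
    (Sum.elim (ICat.emb (fct.map (homOfLE (Set.subset_union_left : U ⊆ U ∪ V))))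
      (ICat.emb (fct.map (homOfLE (Set.subset_union_right : V ⊆ U ∪ V)))))

instance (A : Type) : SmallCategory (DCat A) where
  Hom θ θ' := θ.fct ⟶ θ'.fct
  id θ := 𝟙 θ.fct
  comp {θ _ θ''} φ ψ := (φ ≫ ψ : θ.fct ⟶ θ''.fct)
  id_comp {θ θ'} φ := Category.id_comp (X := θ.fct) (Y := θ'.fct) φ
  comp_id {θ θ'} φ := Category.comp_id (X := θ.fct) (Y := θ'.fct) φ
  assoc {θ₀ θ₁ θ₂ θ₃} φ ψ χ :=
    Category.assoc (W := θ₀.fct) (X := θ₁.fct) (Y := θ₂.fct) (Z := θ₃.fct) φ ψ χ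

namespace DCat

variable {A : Type} (θ : DCat A)

/-- The cardinality of `θ(U)`. -/
def card (U : Set A) : ℕ := (θ.fct.obj U).card

/-- The map `θ(U) → θ(V)` for `U ⊆ V`. -/
def inc {U V : Set A} (h : U ⊆ V) : Fin (θ.card U) ↪ Fin (θ.card V) := ICat.emb (θ.fct.map (homOfLE h))

theorem inc_refl {U : Set A} (h : U ⊆ U) : θ.inc h = Function.Embedding.refl _ :=
  θ.fct.map_id U

theorem inc_inc {U V W : Set A} (h : U ⊆ V) (h' : V ⊆ W) (i : Fin (θ.card U)) :
    θ.inc h' (θ.inc h i) = θ.inc (h.trans h') i :=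
  (DFunLike.congr_fun (congrArg ICat.emb (θ.fct.map_comp (homOfLE h) (homOfLE h'))) i).symm

/-- The injective map `θ(U) ⊔ θ(V) → θ(W)` for disjoint subsets `U`, `V` of `W`. -/
def emb {U V W : Set A} (hU : U ⊆ W) (hV : V ⊆ W) (h : Disjoint U V) :
    Fin (θ.card U) ⊕ Fin (θ.card V) ↪ Fin (θ.card W) where
  toFun := Sum.elim (θ.inc hU) (θ.inc hV)
  inj' := by
    have h1 : Function.Injective (θ.inc (Set.union_subset hU hV) ∘
        Sum.elim (θ.inc Set.subset_union_left) (θ.inc Set.subset_union_right)) :=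
      (θ.inc (Set.union_subset hU hV)).injective.comp (θ.coprod U V h).injective
    have h2 : (Sum.elim (θ.inc hU) (θ.inc hV)) = θ.inc (Set.union_subset hU hV) ∘
        Sum.elim (θ.inc Set.subset_union_left) (θ.inc Set.subset_union_right) := by
      funext i
      rcases i with i | i
      · exact (θ.inc_inc Set.subset_union_left (Set.union_subset hU hV) i).symm
      · exact (θ.inc_inc Set.subset_union_right (Set.union_subset hU hV) i).symm
    rw [h2]
    exact h1

end DCat

namespace CommIMonoid

variable (X : CommIMonoid.{u}) {A : Type}

/-- The product of the spaces `X(θ({a}))` over all `a ∈ S̄`. -/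
abbrev Fam (θ : DCat A) : Type u := ∀ a : A, X.obj (θ.card {a})

variable {X}

/-- A family of elements `h(U) ∈ X(θ(U))` is coherent, if `h(∅)` is the base point and
`h(U ∪ V) = h(U) · h(V)` for disjoint `U`, `V`. -/
structure Coherent (θ : DCat A) (h : ∀ U : Set A, X.obj (θ.card U)) : Prop where
  empty : h ∅ = X.pt _
  union : ∀ (U V : Set A) (hd : Disjoint U V), h (U ∪ V) =
    X.mulE (θ.emb Set.subset_union_left Set.subset_union_right hd) (h U) (h V)

theorem Coherent.eq_mulE {θ : DCat A} {h : ∀ U : Set A, X.obj (θ.card U)} (H : Coherent θ h)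
    {U V W : Set A} (hU : U ⊆ W) (hV : V ⊆ W) (hd : Disjoint U V) (hW : W = U ∪ V) :
    h W = X.mulE (θ.emb hU hV hd) (h U) (h V) := by
  subst hW
  exact H.union U V hd

theorem Coherent.unique [Finite A] {θ : DCat A} {h h' : ∀ U : Set A, X.obj (θ.card U)}
    (H : Coherent θ h) (H' : Coherent θ h') (hs : ∀ a, h {a} = h' {a}) (U : Set A) :
    h U = h' U := by
  induction U, U.toFinite using Set.Finite.induction_on with
  | empty => rw [H.empty, H'.empty]
  | @insert a U ha _ ih =>
    have hd : Disjoint {a} U := Set.disjoint_singleton_left.2 ha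
    rw [Set.insert_eq, H.union _ _ hd, H'.union _ _ hd, hs, ih]

theorem exists_coherent (θ : DCat A) (S : Set A) (hS : S.Finite) :
    ∃ H : ∀ U : Set A, X.Fam θ → X.obj (θ.card U), (∀ U, KCont.{u} (H U)) ∧
      ∀ g, Coherent θ (fun U => H U g) ∧ (∀ a ∈ S, H {a} g = g a) ∧
        ∀ a ∉ S, H {a} g = X.pt _ := by
  classical
  induction S, hS using Set.Finite.induction_on with
  | empty =>
    refine ⟨fun U _ => X.pt _, fun U => continuous_const.continuousGeneratedBy, fun g =>
      ⟨⟨rfl, fun U V hd => ?_⟩, by simp, by simp⟩⟩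
    rw [X.mulE_pt_left, X.map_pt]
  | @insert a S ha _ ih =>
    obtain ⟨H, hc, hH⟩ := ih
    have sub1 : ∀ {U : Set A}, a ∈ U → {a} ⊆ U := @fun U h => Set.singleton_subset_iff.2 h
    have sub2 : ∀ {U : Set A}, U \ {a} ⊆ U := @fun U => Set.sdiff_subset
    have dj : ∀ {U : Set A}, Disjoint {a} (U \ {a}) := @fun U => Set.disjoint_sdiff_right
    let H' : ∀ U : Set A, X.Fam θ → X.obj (θ.card U) := fun U g =>
      if h : a ∈ U then X.mulE (θ.emb (sub1 h) sub2 dj) (g a) (H (U \ {a}) g) else H U g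
    have H'pos : ∀ {U : Set A} (h : a ∈ U) g,
        H' U g = X.mulE (θ.emb (sub1 h) sub2 dj) (g a) (H (U \ {a}) g) := fun h g => dif_pos h
    have H'neg : ∀ {U : Set A} (h : a ∉ U) g, H' U g = H U g := fun h g => dif_neg h
    refine ⟨H', fun U => ?_, fun g => ⟨⟨?_, ?_⟩, ?_, ?_⟩⟩
    · by_cases h : a ∈ U
      · have : H' U = fun g => X.mulE (θ.emb (sub1 h) sub2 dj) (g a) (H (U \ {a}) g) :=
          funext fun g => H'pos h g
        rw [this]
        refine (kcont_iff _).2 fun K _ _ _ g hg => ?_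
        refine (kcont_iff _).1 (X.mulE_continuous _) K (fun k => (g k a, H (U \ {a}) (g k)))
          (((continuous_apply a).comp hg).prodMk ((kcont_iff _).1 (hc _) K g hg))
      · have : H' U = H U := funext fun g => H'neg h g
        rw [this]
        exact hc U
    · exact (H'neg (Set.notMem_empty a) g).trans (hH g).1.empty
    · -- the case that `a` lies in the first set
      have key : ∀ (U V W : Set A) (hd : Disjoint U V) (hU : U ⊆ W) (hV : V ⊆ W),
          W = U ∪ V → a ∈ U → H' W g = X.mulE (θ.emb hU hV hd) (H' U g) (H' V g) := by
        intro U V W hd hU hV hW haU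
        have haV : a ∉ V := fun h => Set.disjoint_left.1 hd haU h
        have hWa : W \ {a} = (U \ {a}) ∪ V := by
          rw [hW, Set.union_sdiff_distrib, Set.sdiff_singleton_eq_self haV]
        have hd' : Disjoint (U \ {a}) V := hd.mono_left sub2
        rw [H'pos (hU haU), H'pos haU, H'neg haV,
          (hH g).1.eq_mulE (hWa ▸ Set.subset_union_left) (hWa ▸ Set.subset_union_right) hd' hWa]
        refine (X.mulE_assoc _ _ _ _ (fun i => ?_) (fun i => ?_) (fun i => ?_) _ _ _).symm <;>
          simp [DCat.emb, DCat.inc_inc]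
      intro U V hd
      by_cases haU : a ∈ U
      · exact key U V _ hd _ _ rfl haU
      by_cases haV : a ∈ V
      · refine (key V U _ hd.symm Set.subset_union_right Set.subset_union_left
          (Set.union_comm U V) haV).trans ?_
        rw [X.mulE_comm]
        congr 1
        ext i
        rcases i with i | i <;> rfl
      · rw [H'neg haU, H'neg haV, H'neg (by simp [haU, haV])]
        exact (hH g).1.union U V hd
    · rintro b (rfl | hb)
      · have h0 : ∀ W : Set A, W = ∅ → H W g = X.pt _ := by
          rintro _ rfl
          exact (hH g).1.empty
        rw [H'pos (Set.mem_singleton b), h0 _ (Set.sdiff_self), X.mulE_pt_right]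
        refine Eq.trans (congrArg (fun e => X.map e (g b)) ?_) (X.map_id _)
        exact θ.inc_refl _
      · rw [H'neg (fun h : a = b => ha (h ▸ hb))]
        exact (hH g).2.1 b hb
    · intro b hb
      rw [H'neg (fun h : a = b => hb (Or.inl h.symm))]
      exact (hH g).2.2 b fun h => hb (Or.inr h)

variable [Finite A]

/-- The product `∏_{a ∈ U} ι_*(g_a) ∈ X(θ(U))` of a family of elements `g_a ∈ X(θ({a}))`, for
`U ⊆ S̄`. It is defined as the value at `U` of the unique coherent family which consists of the
`g_a` on one-element sets; equivalently, it is the iterated product `μ(g_{a₁}, …, g_{a_r})`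
for `U = {a₁, …, a_r}`, transported along the bijection
`θ({a₁}) ⊔ ⋯ ⊔ θ({a_r}) → θ(U)`. -/
noncomputable def mulU (θ : DCat A) (U : Set A) (g : X.Fam θ) : X.obj (θ.card U) :=
  (exists_coherent (X := X) θ Set.univ Set.finite_univ).choose U g

theorem mulU_kcont (θ : DCat A) (U : Set A) : KCont.{u} (mulU (X := X) θ U) :=
  (exists_coherent (X := X) θ Set.univ Set.finite_univ).choose_spec.1 U

theorem mulU_coherent (θ : DCat A) (g : X.Fam θ) : Coherent θ fun U => mulU θ U g :=
  ((exists_coherent (X := X) θ Set.univ Set.finite_univ).choose_spec.2 g).1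

theorem mulU_singleton (θ : DCat A) (g : X.Fam θ) (a : A) : mulU θ {a} g = g a :=
  ((exists_coherent (X := X) θ Set.univ Set.finite_univ).choose_spec.2 g).2.1 a trivial

theorem mulU_eq {θ : DCat A} {h : ∀ U : Set A, X.obj (θ.card U)} (H : Coherent θ h) (U : Set A) :
    mulU θ U (fun a => h {a}) = h U :=
  (mulU_coherent θ _).unique H (fun a => mulU_singleton θ _ a) U

end CommIMonoid

end EHI

namespace EHI

/-- An operation from the subsets of `B` to the subsets of `A`, which preserves unions and
disjointness, such as the preimage of subsets under a pointed map. -/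
structure SetOp (A B : Type) where
  toFun : Set B → Set A
  union : ∀ U V, toFun (U ∪ V) = toFun U ∪ toFun V
  disjoint : ∀ U V, Disjoint U V → Disjoint (toFun U) (toFun V)

namespace SetOp

variable {A B C : Type}

theorem mono (P : SetOp A B) {U V : Set B} (h : U ⊆ V) : P.toFun U ⊆ P.toFun V := by
  rw [← Set.union_eq_self_of_subset_left h, P.union]
  exact Set.subset_union_left

theorem empty (P : SetOp A B) : P.toFun ∅ = ∅ :=
  disjoint_self.1 (P.disjoint ∅ ∅ disjoint_bot_left)

/-- The preimage operation `V ↦ κ⁻¹(V)` of a pointed map `κ : A ⊔ {*} → B ⊔ {*}`. -/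
def preimage (κ : A → Option B) : SetOp A B where
  toFun V := {a | ∃ b ∈ V, κ a = some b}
  union U V := by
    ext a
    simp only [Set.mem_ofPred_eq, Set.mem_union, or_and_right, exists_or]
  disjoint U V h := Set.disjoint_left.2 fun a ⟨b, hb, h1⟩ ⟨c, hc, h2⟩ =>
    Set.disjoint_left.1 h hb (by rwa [Option.some_injective _ (h1.symm.trans h2)])

/-- The composite operation. -/
def comp (P : SetOp A B) (Q : SetOp B C) : SetOp A C where
  toFun U := P.toFun (Q.toFun U)
  union U V := by rw [Q.union, P.union]
  disjoint U V h := P.disjoint _ _ (Q.disjoint _ _ h)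

theorem preimage_id : preimage (fun a : A => some a) = ⟨id, fun _ _ => rfl, fun _ _ h => h⟩ := by
  simp [preimage, funext_iff]

theorem preimage_comp (κ : A → Option B) (l : B → Option C) :
    preimage (fun a => (κ a).bind l) = (preimage κ).comp (preimage l) := by
  simp only [preimage, comp, SetOp.mk.injEq]
  funext V
  ext a
  simp only [Set.mem_ofPred_eq, Option.bind_eq_some_iff]
  grind

/-- The functor `D(S) → D(T)`, given by `κ_*θ(V) = θ(κ⁻¹(V))`. -/
def push (P : SetOp A B) : DCat A ⥤ DCat B where
  obj θ := ⟨(Monotone.functor fun _ _ h => P.mono h : Set B ⥤ Set A) ⋙ θ.fct, fun U V hd => by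
    have h : ∀ (W : Set A) (hU : P.toFun U ⊆ W) (hV : P.toFun V ⊆ W),
        W = P.toFun U ∪ P.toFun V → Function.Bijective
          (Sum.elim (ICat.emb (θ.fct.map (homOfLE hU))) (ICat.emb (θ.fct.map (homOfLE hV)))) := by
      rintro W hU hV rfl
      exact θ.coprod _ _ (P.disjoint U V hd)
    exact h _ _ _ (P.union U V)⟩
  map φ := Functor.whiskerLeft _ φ
  map_id _ := rfl
  map_comp _ _ := rfl

end SetOp

namespace CommIMonoid

variable (X : CommIMonoid.{u}) {A B C : Type}

/-- The product of the spaces `X(θ({a}))`, with the compactly generated product topology. -/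
def KFam (θ : DCat A) : Type u := X.Fam θ

instance (θ : DCat A) : TopologicalSpace (X.KFam θ) := kTop (X.Fam θ) Pi.topologicalSpace

theorem KFam_continuous {X Y : CommIMonoid.{u}} {θ : DCat A} {θ' : DCat B} {f : X.Fam θ → Y.Fam θ'}
    (hf : KCont.{u} f) : @Continuous (X.KFam θ) (Y.KFam θ') _ _ f :=
  (kTop_continuous_kTop_iff _ _ _).2 hf

/-- The functor on `D(S)` which sends `θ` to the (compactly generated) product of the spaces
`X(θ({a}))` over all `a ∈ S̄`. -/
def famDiag (A : Type) : DCat A ⥤ TopCat.{u} where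
  obj θ := TopCat.of (X.KFam θ)
  map {θ θ'} φ := TopCat.ofHom (X := X.KFam θ) (Y := X.KFam θ')
    ⟨fun g a => X.map (ICat.emb (φ.app {a})) (g a),
      KFam_continuous (Continuous.continuousGeneratedBy
        (continuous_pi fun a => (X.map_continuous _).comp (continuous_apply a)))⟩
  map_id θ := by
    refine TopCat.hom_ext (ContinuousMap.ext fun g => funext fun a => ?_)
    exact X.map_id (g a)
  map_comp φ ψ := by
    refine TopCat.hom_ext (ContinuousMap.ext fun g => funext fun a => ?_)
    exact X.map_comp _ _ (g a)

variable {X}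

theorem mulU_naturality [Finite A] {θ θ' : DCat A} (φ : θ ⟶ θ') (g : X.Fam θ) (U : Set A) :
    mulU θ' U (fun a => X.map (ICat.emb (φ.app {a})) (g a)) =
      X.map (ICat.emb (φ.app U)) (mulU θ U g) := by
  have hφ : ∀ {V W : Set A} (h : V ⊆ W) (i : Fin (θ.card V)),
      ICat.emb (φ.app W) (θ.inc h i) = θ'.inc h (ICat.emb (φ.app V) i) := fun h i =>
    DFunLike.congr_fun (congrArg ICat.emb (φ.naturality (homOfLE h))) i
  have H : Coherent θ' fun U => X.map (ICat.emb (φ.app U)) (mulU θ U g) := by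
    refine ⟨?_, fun V W hd => ?_⟩
    · rw [(mulU_coherent θ g).empty]
      exact X.map_pt _
    · rw [(mulU_coherent θ g).union V W hd]
      refine (X.map_mulE _ _ _ _).trans (Eq.trans (congrArg (fun e => X.mulE e _ _) ?_)
        (X.mulE_map _ _ _ _ _).symm)
      ext i
      rcases i with i | i
      · exact congrArg _ (hφ _ i)
      · exact congrArg _ (hφ _ i)
  refine Eq.trans ?_ (mulU_eq H U)
  simp only [mulU_singleton]

theorem coherent_push (P : SetOp A B) {θ : DCat A} {h : ∀ U : Set A, X.obj (θ.card U)}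
    (H : Coherent θ h) : Coherent (P.push.obj θ) fun V => h (P.toFun V) := by
  refine ⟨?_, fun U V hd => ?_⟩
  · have : ∀ W : Set A, W = ∅ → h W = X.pt _ := by
      rintro _ rfl
      exact H.empty
    exact this _ P.empty
  · exact H.eq_mulE (P.mono Set.subset_union_left) (P.mono Set.subset_union_right)
      (P.disjoint U V hd) (P.union U V)

/-- The family `(h_b)_b` with `h_b = ∏_{a ∈ κ⁻¹(b)} ι_*(g_a)`. -/
noncomputable def pushFun [Finite A] (P : SetOp A B) (θ : DCat A) (g : X.Fam θ) :
    X.Fam (P.push.obj θ) := fun b => mulU θ (P.toFun {b}) g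

theorem pushFun_kcont [Finite A] (P : SetOp A B) (θ : DCat A) :
    KCont.{u} (pushFun (X := X) P θ) :=
  (kcont_iff _).2 fun K _ _ _ g hg => continuous_pi fun b =>
    (kcont_iff _).1 (mulU_kcont θ (P.toFun {b})) K g hg

/-- The natural transformation which sends `(g_a)_a` to the family `(h_b)_b`, where
`h_b = ∏_{a ∈ κ⁻¹(b)} ι_*(g_a)`. -/
noncomputable def pushFam [Finite A] (P : SetOp A B) :
    X.famDiag A ⟶ P.push ⋙ X.famDiag B where
  app θ := TopCat.ofHom (X := X.KFam θ) (Y := X.KFam (P.push.obj θ))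
    ⟨pushFun P θ, KFam_continuous (pushFun_kcont P θ)⟩
  naturality θ θ' φ := by
    refine TopCat.hom_ext (ContinuousMap.ext fun g => funext fun b => ?_)
    exact mulU_naturality φ g (P.toFun {b})

/-- The map of nerves of transport categories which induces `Γ(X)(κ)`. -/
noncomputable def pushNerve [Finite A] [Finite B] (P : SetOp A B) :
    srep (X.famDiag A) ⟶ srep (X.famDiag B) := srepMap P.push (pushFam P)

theorem pushNerve_id [Finite A] :
    pushNerve (X := X) (⟨id, fun _ _ => rfl, fun _ _ h => h⟩ : SetOp A A) = 𝟙 _ := by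
  refine NatTrans.ext (funext fun p => ?_)
  refine TopCat.hom_ext (ContinuousMap.ext fun x => ?_)
  refine congrArg (Sigma.mk (β := fun c : Fin (p.unop.len + 1) ⥤ DCat A =>
    (X.famDiag A).obj (c.obj 0)) x.1) ?_
  funext a
  exact mulU_singleton _ _ _

theorem pushNerve_comp [Finite A] [Finite B] [Finite C] (P : SetOp A B) (Q : SetOp B C) :
    pushNerve (X := X) (P.comp Q) = pushNerve P ≫ pushNerve Q := by
  refine NatTrans.ext (funext fun p => ?_)
  refine TopCat.hom_ext (ContinuousMap.ext fun x => ?_)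
  refine congrArg (Sigma.mk (β := fun c : Fin (p.unop.len + 1) ⥤ DCat C =>
    (X.famDiag C).obj (c.obj 0)) (x.1 ⋙ (P.comp Q).push)) ?_
  funext a
  exact (mulU_eq (coherent_push P (mulU_coherent (x.1.obj 0) x.2)) _).symm

variable (X)

/-- The `Γ`-space `Γ(X)` of a commutative `𝓘`-monoid: `Γ(X)(S)` is the homotopy colimit over `D(S)`
of the products of the spaces `X(θ({a}))`. -/
noncomputable def Gam : GammaOp ⥤ TopCat.{u} where
  obj A := hocolim (X.famDiag A.carrier)
  map κ := realization.map (pushNerve (SetOp.preimage κ))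
  map_id A := by
    have h : pushNerve (X := X) (SetOp.preimage (𝟙 A : A ⟶ A)) = 𝟙 _ :=
      (congrArg pushNerve SetOp.preimage_id).trans pushNerve_id
    rw [h, realization.map_id]
  map_comp κ l := by
    have h : pushNerve (X := X) (SetOp.preimage (κ ≫ l)) =
        pushNerve (SetOp.preimage κ) ≫ pushNerve (SetOp.preimage l) :=
      (congrArg pushNerve (SetOp.preimage_comp κ l)).trans (pushNerve_comp _ _)
    rw [h, realization.map_comp]

variable {X} {Y : CommIMonoid.{u}}

theorem map_mulU [Finite A] (ψ : IMonoidHom X.toIMonoid Y.toIMonoid) (θ : DCat A) (g : X.Fam θ)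
    (U : Set A) : ψ.app _ (mulU θ U g) = mulU (X := Y) θ U fun a => ψ.app _ (g a) := by
  have H : Coherent (X := Y) θ fun U => ψ.app _ (mulU θ U g) := by
    refine ⟨?_, fun V W hd => ?_⟩
    · rw [(mulU_coherent θ g).empty]
      exact ψ.app_pt _
    · rw [(mulU_coherent θ g).union V W hd]
      exact ψ.app_mulE _ _ _
  refine (mulU_eq H U).symm.trans ?_
  simp only [mulU_singleton]

/-- The natural transformation of functors on `D(S)` induced by a morphism of commutative
`𝓘`-monoids. -/
def famDiagMap (ψ : IMonoidHom X.toIMonoid Y.toIMonoid) (A : Type) :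
    X.famDiag A ⟶ Y.famDiag A where
  app θ := TopCat.ofHom (X := X.KFam θ) (Y := Y.KFam θ)
    ⟨fun g a => ψ.app _ (g a),
      KFam_continuous (Continuous.continuousGeneratedBy
        (continuous_pi fun a => (ψ.continuous _).comp (continuous_apply a)))⟩
  naturality θ θ' φ := by
    refine TopCat.hom_ext (ContinuousMap.ext fun g => funext fun a => ?_)
    exact ψ.naturality _ (g a)

/-- The map of `Γ`-spaces `Γ(X) → Γ(Y)` induced by a morphism of commutative `𝓘`-monoids. -/
noncomputable def GamMap (ψ : IMonoidHom X.toIMonoid Y.toIMonoid) : X.Gam ⟶ Y.Gam where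
  app A := realization.map (srepMap (𝟭 _) (famDiagMap ψ A.carrier))
  naturality A B κ := by
    refine (realization.map_comp _ _).symm.trans (Eq.trans ?_ (realization.map_comp _ _))
    congr 1
    refine NatTrans.ext (funext fun p => ?_)
    refine TopCat.hom_ext (ContinuousMap.ext fun x => ?_)
    refine congrArg (Sigma.mk (β := fun c : Fin (p.unop.len + 1) ⥤ DCat B.carrier =>
      (Y.famDiag B.carrier).obj (c.obj 0)) (x.1 ⋙ (SetOp.preimage κ).push)) ?_
    funext b
    exact map_mulU ψ _ x.2 _

end CommIMonoid

end EHI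

namespace EHI

/-! ### Delooping of `Γ`-spaces -/

/-- The non-degenerate maps `{0, …, k} → {0, 1}`: these are the `k` elements of the `k`-th set of the
simplicial circle `Δ[1] / ∂Δ[1]` which differ from the base point. The element number
`j ∈ {1, …, k}` is the monotone map which takes the value `1` exactly on `{j, …, k}`. -/
def Cut (k : ℕ) : Type := {c : Fin (k + 1) →o Fin 2 // c 0 = 0 ∧ c (Fin.last k) = 1}

instance (k : ℕ) : Finite (Cut k) :=
  haveI : Finite (Fin (k + 1) →o Fin 2) := DFunLike.finite _
  Subtype.finite

open Classical in
/-- The simplicial finite pointed set `k ↦ [k] = {0, …, k}` (the simplicial circle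
`Δ[1] / ∂Δ[1]`). -/
noncomputable def circle : SimplexCategoryᵒᵖ ⥤ GammaOp where
  obj k := ⟨Cut k.unop.len⟩
  map {k l} f := fun c =>
    if h : c.1 (f.unop.toOrderHom 0) = 0 ∧ c.1 (f.unop.toOrderHom (Fin.last _)) = 1 then
      some ⟨c.1.comp f.unop.toOrderHom, h⟩ else none
  map_id k := funext fun c => dif_pos c.2
  map_comp {k l m} f g := funext fun c => by
    change dite _ _ _ = Option.bind (dite _ _ _) _
    by_cases h : c.1 (f.unop.toOrderHom 0) = 0 ∧ c.1 (f.unop.toOrderHom (Fin.last _)) = 1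
    · rw [dif_pos h]
      rfl
    · rw [dif_neg h, dif_neg, Option.bind_none]
      rintro ⟨h0, h1⟩
      refine h ⟨?_, ?_⟩
      · exact le_antisymm (le_of_le_of_eq (c.1.monotone (f.unop.toOrderHom.monotone
          (Fin.zero_le _))) h0) (Fin.zero_le _)
      · exact le_antisymm (Fin.le_last _) (le_of_eq_of_le h1.symm (c.1.monotone
          (f.unop.toOrderHom.monotone (Fin.le_last _))))

/-- The smash product of finite pointed sets `(S, K) ↦ K ∧ S`. -/
def smash : GammaOp ⥤ GammaOp ⥤ GammaOp where
  obj S :=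
    { obj K := ⟨K.carrier × S.carrier⟩
      map κ := fun p => (κ p.1).map fun k => (k, p.2)
      map_id K := rfl
      map_comp κ l := funext fun p => by
        change (Option.bind (κ p.1) l).map _ = Option.bind ((κ p.1).map _) _
        cases κ p.1 <;> rfl }
  map f :=
    { app K := fun p => (f p.2).map fun s => (p.1, s)
      naturality K L κ := funext fun p => by
        change Option.bind ((κ p.1).map _) _ = Option.bind ((f p.2).map _) _
        cases h : κ p.1 <;> cases h' : f p.2 <;> simp [h, h'] }
  map_id S := rfl
  map_comp f g := by
    refine NatTrans.ext (funext fun K => funext fun p => ?_)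
    change (Option.bind (f p.2) g).map _ = Option.bind ((f p.2).map _) _
    cases f p.2 <;> rfl

/-- The delooping `B_μ A` of a `Γ`-space `A`: `B_μ A (S)` is the realization of the simplicial space
`k ↦ A([k] ∧ S)`. -/
noncomputable def Bmu : (GammaOp ⥤ TopCat.{u}) ⥤ (GammaOp ⥤ TopCat.{u}) where
  obj A :=
    { obj S := realization.obj (circle ⋙ smash.obj S ⋙ A)
      map f := realization.map (Functor.whiskerLeft circle (Functor.whiskerRight (smash.map f) A))
      map_id S := by simp
      map_comp f g := by simp }
  map α :=
    { app S := realization.map (Functor.whiskerLeft circle (Functor.whiskerLeft (smash.obj S) α))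
      naturality S T f := by
        rw [← realization.map_comp, ← realization.map_comp]
        congr 1
        exact NatTrans.ext (funext fun k => α.naturality _) }
  map_id A := by
    ext S : 2
    exact realization.map_id _
  map_comp α β := by
    refine NatTrans.ext (funext fun S => ?_)
    exact realization.map_comp (Functor.whiskerLeft circle (Functor.whiskerLeft (smash.obj S) α))
      (Functor.whiskerLeft circle (Functor.whiskerLeft (smash.obj S) β))

/-- The point `(1 - s, s)` of the topological `1`-simplex. -/
def edge (s : unitInterval) : Simp (SimplexCategory.mk 1) :=
  ⟨![1 - s, s], by
    intro i
    fin_cases i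
    · exact sub_nonneg.2 s.2.2
    · exact s.2.1, by
    change ∑ i : Fin 2, _ = (1 : ℝ)
    simp [Fin.sum_univ_two]⟩

/-- The isomorphism `S ≅ [1] ∧ S`. -/
def toSmash (S : GammaOp) : S ⟶ (smash.obj S).obj (circle.obj (op (SimplexCategory.mk 1))) :=
  fun s => some (⟨OrderHom.id, rfl, rfl⟩, s)

/-- The structure map `A(S) × I → B_μ A (S)` of the delooping, sending `(x, s)` to the point with
coordinates `(1 - s, s)` of the edge `x ∈ A(S) ≅ A([1] ∧ S)`; its adjoint is the map
`A(S) → Ω B_μ A (S)`. -/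
noncomputable def bond (A : GammaOp ⥤ TopCat.{u}) (S : GammaOp) (x : A.obj S)
    (s : unitInterval) : (Bmu.obj A).obj S :=
  GReal.mk (Y := circle ⋙ smash.obj S ⋙ A) (SimplexCategory.mk 1) (A.map (toSmash S) x) (edge s)

end EHI

namespace EHI

/-! ### Products of geometric realizations -/

theorem simp_map_apply {m n : ℕ} (f : Fin (m + 1) →o Fin (n + 1)) (t : stdSimplex ℝ (Fin (m + 1)))
    (i : Fin (n + 1)) : stdSimplex.map f t i = ∑ k, if f k = i then t k else 0 := by
  rw [stdSimplex.map_coe, FunOnFinite.linearMap_apply_apply, Finset.sum_filter]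

/-- A monotone map of simplices is determined by the image of an interior point. -/
theorem simp_map_unique {m n : ℕ} (f g : Fin (m + 1) →o Fin (n + 1))
    (t : stdSimplex ℝ (Fin (m + 1))) (ht : ∀ k, 0 < t k)
    (h : stdSimplex.map f t = stdSimplex.map g t) : f = g := by
  have key : ∀ (f g : Fin (m + 1) →o Fin (n + 1)), stdSimplex.map f t = stdSimplex.map g t →
      ∀ k, ¬ f k < g k := by
    intro f g h k hk
    have cdf : ∀ (f : Fin (m + 1) →o Fin (n + 1)) (a : Fin (n + 1)),
        ∑ i ∈ Finset.Iic a, stdSimplex.map f t i = ∑ j, if f j ≤ a then t j else 0 := by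
      intro f a
      simp only [simp_map_apply]
      rw [Finset.sum_comm]
      refine Finset.sum_congr rfl fun j _ => ?_
      rw [Finset.sum_ite_eq]
      simp
    have h1 := cdf f (f k)
    rw [h, cdf g (f k)] at h1
    refine absurd h1 (ne_of_lt ?_)
    refine Finset.sum_lt_sum (fun j _ => ?_) ⟨k, Finset.mem_univ k, ?_⟩
    · split_ifs with h2 h3
      · exact le_rfl
      · refine absurd (f.monotone ?_) h3
        by_contra hjk
        exact absurd (g.monotone (le_of_not_ge hjk)) (not_le.2 (h2.trans_lt hk))
      · exact (ht j).le
      · exact le_rfl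
    · rw [if_neg (not_le.2 hk), if_pos le_rfl]
      exact ht k
  ext k
  exact congrArg _ (le_antisymm (not_lt.1 (key g f h.symm k)) (not_lt.1 (key f g h k)))

theorem overlap_eq {a b c d : ℝ} (h : a ≤ b) (h' : c ≤ d) :
    max 0 (min b d - max a c) = max a (min b d) - max a (min b c) := by
  simp only [max_def, min_def]
  split_ifs <;> linarith

/-- The sum of the first `k` coordinates of a point of the simplex. -/
def cum {n : ℕ} (t : stdSimplex ℝ (Fin (n + 1))) (k : ℕ) : ℝ :=
  ∑ i ∈ Finset.range k, if h : i < n + 1 then t ⟨i, h⟩ else 0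

theorem cum_succ {n : ℕ} (t : stdSimplex ℝ (Fin (n + 1))) (i : Fin (n + 1)) :
    cum t (i + 1) = cum t i + t i := by
  rw [cum, cum, Finset.sum_range_succ, dif_pos i.2]

theorem cum_mono {n : ℕ} (t : stdSimplex ℝ (Fin (n + 1))) : Monotone (cum t) := by
  refine monotone_nat_of_le_succ fun k => ?_
  rw [cum, cum, Finset.sum_range_succ]
  have : 0 ≤ if h : k < n + 1 then t ⟨k, h⟩ else 0 := by
    split_ifs
    · exact t.2.1 _
    · exact le_rfl
  linarith

theorem cum_last {n : ℕ} (t : stdSimplex ℝ (Fin (n + 1))) : cum t (n + 1) = 1 := by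
  rw [cum, ← Fin.sum_univ_eq_sum_range (fun i => if h : i < n + 1 then t ⟨i, h⟩ else 0)]
  refine Eq.trans (Finset.sum_congr rfl fun i _ => ?_) t.2.2
  exact dif_pos i.2

/-- The length of the intersection of the `i`-th interval of `t` and the `j`-th interval of `s`. -/
def overlap {n m : ℕ} (t : stdSimplex ℝ (Fin (n + 1))) (s : stdSimplex ℝ (Fin (m + 1)))
    (i j : ℕ) : ℝ :=
  max 0 (min (cum t (i + 1)) (cum s (j + 1)) - max (cum t i) (cum s j))

theorem sum_overlap {n m : ℕ} (t : stdSimplex ℝ (Fin (n + 1))) (s : stdSimplex ℝ (Fin (m + 1)))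
    (i : Fin (n + 1)) : ∑ j : Fin (m + 1), overlap t s i j = t i := by
  have h1 : ∀ j, overlap t s i j = max (cum t i) (min (cum t (i + 1)) (cum s (j + 1))) -
      max (cum t i) (min (cum t (i + 1)) (cum s j)) := fun j =>
    overlap_eq (cum_mono t (Nat.le_succ _)) (cum_mono s (Nat.le_succ _))
  have h0 : (0 : ℝ) ≤ cum t i := by
    simpa [cum] using cum_mono t (Nat.zero_le i)
  have h2 : cum t (i + 1) ≤ 1 := (cum_mono t i.2).trans_eq (cum_last t)
  have h3 := cum_mono t (Nat.le_succ i)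
  rw [Fin.sum_univ_eq_sum_range (fun j => overlap t s i j)]
  simp only [h1]
  rw [Finset.sum_range_sub (fun j => max (cum t i) (min (cum t (i + 1)) (cum s j))), cum_last,
    show cum s 0 = 0 by simp [cum], min_eq_left h2, max_eq_right h3,
    min_eq_right (h0.trans h3), max_eq_left h0, cum_succ]
  ring

theorem overlap_comm {n m : ℕ} (t : stdSimplex ℝ (Fin (n + 1))) (s : stdSimplex ℝ (Fin (m + 1)))
    (i j : ℕ) : overlap t s i j = overlap s t j i := by
  rw [overlap, overlap, min_comm, max_comm (cum t i)]

theorem overlap_chain {n m : ℕ} (t : stdSimplex ℝ (Fin (n + 1))) (s : stdSimplex ℝ (Fin (m + 1)))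
    {i j i' j' : ℕ} (h : 0 < overlap t s i j) (h' : 0 < overlap t s i' j') (hi : i < i') :
    j ≤ j' := by
  by_contra hj
  have h1 := cum_mono t (show i + 1 ≤ i' from hi)
  have h2 := cum_mono s (show j' + 1 ≤ j by omega)
  simp only [overlap, lt_max_iff, lt_irrefl, false_or, sub_pos, max_lt_iff, lt_min_iff] at h h'
  linarith [h.1.1, h.1.2, h.2.1, h.2.2, h'.1.1, h'.1.2, h'.2.1, h'.2.2]

/-- Any two points of simplices are images of an interior point of a simplex under monotone
maps. -/
theorem exists_common (n m : SimplexCategory) (t : Simp n) (s : Simp m) :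
    ∃ (k : SimplexCategory) (f : k ⟶ n) (g : k ⟶ m) (r : Simp k), (∀ i, 0 < r i) ∧
      k.len < (n.len + 1) * (m.len + 1) ∧ stdSimplex.map f.toOrderHom r = t ∧ stdSimplex.map g.toOrderHom r = s := by
  classical
  let L := Fin (n.len + 1) ×ₗ Fin (m.len + 1)
  let w : L → ℝ := fun p => overlap t s (ofLex p).1 (ofLex p).2
  have w0 : ∀ p, 0 ≤ w p := fun p => le_max_left _ _
  let E : Finset L := Finset.univ.filter fun p => 0 < w p
  have sumL : ∀ φ : L → ℝ, (∀ p, w p = 0 → φ p = 0) →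
      ∑ p ∈ E, φ p = ∑ a : Fin (n.len + 1), ∑ b : Fin (m.len + 1), φ (toLex (a, b)) := by
    intro φ hφ
    rw [← Fintype.sum_prod_type' (f := fun a b => φ (toLex (a, b))), Finset.sum_filter]
    refine Eq.trans (Finset.sum_congr rfl fun p _ => ?_) (Equiv.sum_comp toLex φ).symm
    split_ifs with h
    · rfl
    · exact (hφ p (le_antisymm (not_lt.1 h) (w0 p))).symm
  have hsum : ∑ p ∈ E, w p = 1 := by
    rw [sumL w fun p h => h]
    exact (Finset.sum_congr rfl fun i _ => sum_overlap t s i).trans t.2.2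
  have hE : E.Nonempty := by
    rw [Finset.nonempty_iff_ne_empty]
    rintro h
    rw [h] at hsum
    simp at hsum
  obtain ⟨N, hN⟩ : ∃ N, E.card = N + 1 := ⟨E.card - 1, by have := hE.card_pos; omega⟩
  let e := E.orderEmbOfFin hN
  have he : ∀ k, 0 < w (e k) := fun k =>
    (Finset.mem_filter.1 (Finset.orderEmbOfFin_mem E hN k)).2
  have sumE : ∀ φ : L → ℝ, ∑ k, φ (e k) = ∑ p ∈ E, φ p := by
    intro φ
    conv_rhs => rw [← Finset.map_orderEmbOfFin_univ E hN, Finset.sum_map]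
    rfl
  let f : Fin (N + 1) →o Fin (n.len + 1) := ⟨fun k => (ofLex (e k)).1, fun k l h =>
    Prod.Lex.monotone_fst _ _ (e.monotone h)⟩
  let g : Fin (N + 1) →o Fin (m.len + 1) := ⟨fun k => (ofLex (e k)).2, fun k l h => by
    rcases (Prod.Lex.le_iff).1 (e.monotone h) with h1 | h1
    · exact overlap_chain t s (he k) (he l) h1
    · exact h1.2⟩
  refine ⟨SimplexCategory.mk N, SimplexCategory.mkHom f, SimplexCategory.mkHom g,
    ⟨fun k => w (e k), fun k => w0 _, (sumE w).trans hsum⟩, he, ?_, ?_, ?_⟩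
  · have h1 := Finset.card_le_univ E
    have h2 : Fintype.card L = (n.len + 1) * (m.len + 1) := by
      rw [Fintype.card_lex, Fintype.card_prod, Fintype.card_fin, Fintype.card_fin]
    rw [h2, hN] at h1
    exact h1
  · refine DFunLike.ext _ _ fun i => ?_
    refine (simp_map_apply f _ i).trans ((sumE fun p => if (ofLex p).1 = i then w p else 0).trans ?_)
    rw [sumL _ fun p h => by simp [h], ← sum_overlap t s i, Finset.sum_comm]
    refine Finset.sum_congr rfl fun j _ => ?_
    exact (Fintype.sum_eq_single i fun x hx => if_neg hx).trans (if_pos rfl)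
  · refine DFunLike.ext _ _ fun j => ?_
    refine (simp_map_apply g _ j).trans ((sumE fun p => if (ofLex p).2 = j then w p else 0).trans ?_)
    rw [sumL _ fun p h => by simp [h], ← sum_overlap s t j]
    refine Finset.sum_congr rfl fun i _ => ?_
    rw [overlap_comm s t]
    exact (Fintype.sum_eq_single j fun x hx => if_neg hx).trans (if_pos rfl)

end EHI

namespace EHI

/-- A levelwise multiplication `A × B → C` of simplicial spaces, which is continuous on compactly
generated products. -/
structure LevelMul (A B C : SimplicialObject TopCat.{u}) where
  mul : ∀ n : SimplexCategory, A.obj (op n) → B.obj (op n) → C.obj (op n)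
  natural : ∀ {m n : SimplexCategory} (f : m ⟶ n) (x : A.obj (op n)) (y : B.obj (op n)),
    C.map f.op (mul n x y) = mul m (A.map f.op x) (B.map f.op y)
  kcont : ∀ n, KCont.{u} fun p : A.obj (op n) × B.obj (op n) => mul n p.1 p.2

namespace LevelMul

variable {A B C : SimplicialObject TopCat.{u}} (M : LevelMul A B C)

theorem mk_map {m n : SimplexCategory} (f : m ⟶ n) (y : A.obj (op n)) (t : Simp m) :
    GReal.mk m (A.map f.op y) t = GReal.mk n y (stdSimplex.map f.toOrderHom t) :=
  Quot.sound (RealRel.mk f y t)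

/-- The point of `|C|` obtained from `x`, `y` and a point of a simplex mapping to the simplices
of `x` and `y`. -/
def val {k n m : SimplexCategory} (f : k ⟶ n) (g : k ⟶ m) (x : A.obj (op n)) (y : B.obj (op m))
    (r : Simp k) : GReal C :=
  GReal.mk k (M.mul k (A.map f.op x) (B.map g.op y)) r

theorem val_map {l k n m : SimplexCategory} (a : l ⟶ k) (f : k ⟶ n) (g : k ⟶ m)
    (x : A.obj (op n)) (y : B.obj (op m)) (r : Simp l) :
    M.val f g x y (stdSimplex.map a.toOrderHom r) = M.val (a ≫ f) (a ≫ g) x y r := by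
  rw [val, ← mk_map, M.natural, val, op_comp, op_comp, A.map_comp, B.map_comp]
  rfl

theorem val_congr {k k' n m : SimplexCategory} (f : k ⟶ n) (g : k ⟶ m) (f' : k' ⟶ n) (g' : k' ⟶ m)
    (x : A.obj (op n)) (y : B.obj (op m)) (r : Simp k) (r' : Simp k')
    (hf : stdSimplex.map f.toOrderHom r = stdSimplex.map f'.toOrderHom r')
    (hg : stdSimplex.map g.toOrderHom r = stdSimplex.map g'.toOrderHom r') :
    M.val f g x y r = M.val f' g' x y r' := by
  obtain ⟨l, a, b, R, hR, -, rfl, rfl⟩ := exists_common k k' r r'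
  have key : ∀ {j : SimplexCategory} (h : k ⟶ j) (h' : k' ⟶ j),
      stdSimplex.map h.toOrderHom (stdSimplex.map a.toOrderHom R) =
        stdSimplex.map h'.toOrderHom (stdSimplex.map b.toOrderHom R) → a ≫ h = b ≫ h' := by
    intro j h h' e
    rw [stdSimplex.map_comp_apply, stdSimplex.map_comp_apply] at e
    exact SimplexCategory.Hom.ext _ _ (simp_map_unique (a ≫ h).toOrderHom (b ≫ h').toOrderHom R hR e)
  rw [M.val_map, M.val_map, key f f' hf, key g g' hg]

/-- The product of points of simplices. -/
noncomputable def preMul (p : PreReal A) (q : PreReal B) : GReal C :=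
  M.val (exists_common p.1 q.1 p.2.2 q.2.2).choose_spec.choose
    (exists_common p.1 q.1 p.2.2 q.2.2).choose_spec.choose_spec.choose p.2.1 q.2.1
    (exists_common p.1 q.1 p.2.2 q.2.2).choose_spec.choose_spec.choose_spec.choose

theorem preMul_eq {k n m : SimplexCategory} (f : k ⟶ n) (g : k ⟶ m) (x : A.obj (op n))
    (y : B.obj (op m)) (r : Simp k) :
    M.preMul ⟨n, x, stdSimplex.map f.toOrderHom r⟩ ⟨m, y, stdSimplex.map g.toOrderHom r⟩ =
      M.val f g x y r := by
  have h := (exists_common n m (stdSimplex.map f.toOrderHom r)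
    (stdSimplex.map g.toOrderHom r)).choose_spec.choose_spec.choose_spec.choose_spec.2.2
  exact M.val_congr _ _ _ _ _ _ _ _ h.1 h.2

/-- The map `|A| × |B| → |C|` induced by a levelwise multiplication. -/
noncomputable def rmul : GReal A → GReal B → GReal C :=
  Quot.lift (fun p => Quot.lift (fun q => M.preMul p q) (by
    obtain ⟨n, x, t⟩ := p
    rintro _ _ ⟨φ, y, s⟩
    obtain ⟨k, f, g, r, -, -, rfl, rfl⟩ := exists_common _ _ t s
    rw [M.preMul_eq, stdSimplex.map_comp_apply]
    refine Eq.trans ?_ (M.preMul_eq f (g ≫ φ) x y r).symm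
    rw [val, val, op_comp, B.map_comp]
    rfl)) (by
    rintro _ _ ⟨φ, x, t⟩
    funext q
    obtain ⟨m, y, s⟩ := q
    obtain ⟨k, f, g, r, -, -, rfl, rfl⟩ := exists_common _ _ t s
    change M.preMul _ _ = M.preMul _ _
    rw [M.preMul_eq, stdSimplex.map_comp_apply]
    refine Eq.trans ?_ (M.preMul_eq (f ≫ φ) g x y r).symm
    rw [val, val, op_comp, A.map_comp]
    rfl)

theorem rmul_mk (n : SimplexCategory) (x : A.obj (op n)) (y : B.obj (op n)) (t : Simp n) :
    M.rmul (GReal.mk n x t) (GReal.mk n y t) = GReal.mk n (M.mul n x y) t := by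
  have h := M.preMul_eq (𝟙 n) (𝟙 n) x y t
  rw [show stdSimplex.map (𝟙 n : n ⟶ n).toOrderHom t = t from stdSimplex.map_id_apply t,
    val, op_id, A.map_id, B.map_id] at h
  exact h

end LevelMul

theorem exists_mk {A : SimplicialObject TopCat.{u}} (a : GReal A) :
    ∃ (n : SimplexCategory) (x : A.obj (op n)) (t : Simp n), a = GReal.mk n x t := by
  obtain ⟨n, x, t⟩ := a
  exact ⟨n, x, t, rfl⟩

/-- Two points of geometric realizations can be represented over the same point of a simplex. -/
theorem exists_mk₂ {A B : SimplicialObject TopCat.{u}} (a : GReal A) (b : GReal B) :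
    ∃ (n : SimplexCategory) (x : A.obj (op n)) (y : B.obj (op n)) (t : Simp n),
      a = GReal.mk n x t ∧ b = GReal.mk n y t := by
  obtain ⟨n, x, t, rfl⟩ := exists_mk a
  obtain ⟨m, y, s, rfl⟩ := exists_mk b
  obtain ⟨k, f, g, r, -, -, rfl, rfl⟩ := exists_common _ _ t s
  exact ⟨k, A.map f.op x, B.map g.op y, r, (LevelMul.mk_map f x r).symm,
    (LevelMul.mk_map g y r).symm⟩

theorem exists_mk₃ {A B C : SimplicialObject TopCat.{u}} (a : GReal A) (b : GReal B)
    (c : GReal C) : ∃ (n : SimplexCategory) (x : A.obj (op n)) (y : B.obj (op n))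
      (z : C.obj (op n)) (t : Simp n),
      a = GReal.mk n x t ∧ b = GReal.mk n y t ∧ c = GReal.mk n z t := by
  obtain ⟨n, x, y, t, rfl, rfl⟩ := exists_mk₂ a b
  obtain ⟨m, z, s, rfl⟩ := exists_mk c
  obtain ⟨k, f, g, r, -, -, rfl, rfl⟩ := exists_common _ _ t s
  exact ⟨k, A.map f.op x, B.map f.op y, C.map g.op z, r, (LevelMul.mk_map f x r).symm,
    (LevelMul.mk_map f y r).symm, (LevelMul.mk_map g z r).symm⟩

/-! Continuity of the product -/

theorem continuous_cg_prod {Y L : Type u} {Z : Type v} [TopologicalSpace Y] [TopologicalSpace L]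
    [TopologicalSpace Z] [IsGeneratedBy KH.{u} Y] [CompactSpace L] [T2Space L] (g : Y × L → Z)
    (hg : ∀ (K : Type u) [TopologicalSpace K] [CompactSpace K] [T2Space K] (x : K → Y),
      Continuous x → Continuous fun p : K × L => g (x p.1, p.2)) : Continuous g := by
  let G : Y → C(L, Z) := fun y => ⟨fun l => g (y, l),
    (hg PUnit (fun _ => y) continuous_const).comp (Continuous.prodMk_right PUnit.unit)⟩
  have hG : Continuous G := (IsGeneratedBy.continuous_iff KH.{u} G).2 fun K x =>
    ContinuousMap.continuous_of_continuous_uncurry _ (hg (KH K) x x.continuous)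
  exact ContinuousMap.continuous_uncurry_of_continuous ⟨G, hG⟩

theorem continuous_real_prod {Y : SimplicialObject TopCat.{u}} {L : Type u} {Z : Type v}
    [TopologicalSpace L] [TopologicalSpace Z] [∀ n, IsGeneratedBy KH.{u} (Y.obj n)]
    [CompactSpace L] [T2Space L] (g : GReal Y × L → Z)
    (hg : ∀ (n : SimplexCategory) (K : Type u) [TopologicalSpace K] [CompactSpace K] [T2Space K]
      (x : K → Y.obj (op n)), Continuous x →
      Continuous fun p : K × (Simp n × L) => g (GReal.mk n (x p.1) p.2.1, p.2.2)) :
    Continuous g := by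
  have h1 : ∀ n : SimplexCategory, Continuous fun p : Y.obj (op n) × (Simp n × L) =>
      g (GReal.mk n p.1 p.2.1, p.2.2) := fun n => continuous_cg_prod _ fun K _ _ _ x hx => hg n K x hx
  refine Topology.IsQuotientMap.continuous_lift_prod_left (f := Quot.mk (RealRel Y))
    isQuotientMap_quot_mk ?_
  let G : PreReal Y → C(L, Z) := fun p => ⟨fun l => g (Quot.mk _ p, l),
    (h1 p.1).comp (g := _) (f := fun l => (p.2.1, p.2.2, l)) (by fun_prop)⟩
  have hG : Continuous G := continuous_sigma fun n =>
    ContinuousMap.continuous_of_continuous_uncurry _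
      ((h1 n).comp (f := fun q : (Y.obj (op n) × Simp n) × L => (q.1.1, q.1.2, q.2)) (by fun_prop))
  exact ContinuousMap.continuous_uncurry_of_continuous ⟨G, hG⟩

namespace LevelMul

variable {A B C : SimplicialObject TopCat.{u}} (M : LevelMul A B C)

theorem continuous_mk {K : Type v} [TopologicalSpace K] {n : SimplexCategory}
    {y : K → C.obj (op n)} {t : K → Simp n} (hy : Continuous y) (ht : Continuous t) :
    Continuous fun k => GReal.mk n (y k) (t k) :=
  continuous_quot_mk.comp (continuous_sigmaMk.comp (hy.prodMk ht))

theorem continuous_preMul {K : Type u} [TopologicalSpace K] [CompactSpace K] [T2Space K]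
    {n m : SimplexCategory} {x : K → A.obj (op n)} {t : K → Simp n} {y : K → B.obj (op m)}
    {s : K → Simp m} (hx : Continuous x) (ht : Continuous t) (hy : Continuous y)
    (hs : Continuous s) : Continuous fun k => M.preMul ⟨n, x k, t k⟩ ⟨m, y k, s k⟩ := by
  let ι := Σ N : Fin ((n.len + 1) * (m.len + 1)),
    (SimplexCategory.mk N ⟶ n) × (SimplexCategory.mk N ⟶ m)
  let S : ι → Type u := fun i => {p : K × Simp (SimplexCategory.mk i.1) //
    stdSimplex.map i.2.1.toOrderHom p.2 = t p.1 ∧ stdSimplex.map i.2.2.toOrderHom p.2 = s p.1}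
  have hS : ∀ i, CompactSpace (S i) := fun i => by
    refine isCompact_iff_compactSpace.1 (IsClosed.isCompact ?_)
    refine IsClosed.inter (isClosed_eq ?_ (ht.comp continuous_fst))
      (isClosed_eq ?_ (hs.comp continuous_fst))
    · exact (stdSimplex.continuous_map _).comp continuous_snd
    · exact (stdSimplex.continuous_map _).comp continuous_snd
  have hfin : ∀ N k : SimplexCategory, Finite (N ⟶ k) := fun N k =>
    haveI : Finite (Fin (N.len + 1) →o Fin (k.len + 1)) := DFunLike.finite _
    Finite.of_injective (fun f : N ⟶ k => f.toOrderHom) fun _ _ h => SimplexCategory.Hom.ext _ _ h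
  have hι : Finite ι := inferInstance
  let π : (Σ i, S i) → K := fun p => p.2.1.1
  have hπ : Continuous π := continuous_sigma fun i =>
    continuous_fst.comp continuous_subtype_val
  have hq : IsQuotientMap π := by
    refine IsClosedMap.isQuotientMap hπ.isClosedMap hπ fun k => ?_
    obtain ⟨N, f, g, r, -, hN, h1, h2⟩ := exists_common n m (t k) (s k)
    exact ⟨⟨⟨⟨N.len, hN⟩, f, g⟩, ⟨(k, r), h1, h2⟩⟩, rfl⟩
  rw [hq.continuous_iff]
  refine continuous_sigma fun i => ?_
  have h1 : ∀ p : S i, M.preMul ⟨n, x p.1.1, t p.1.1⟩ ⟨m, y p.1.1, s p.1.1⟩ =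
      M.val i.2.1 i.2.2 (x p.1.1) (y p.1.1) p.1.2 := by
    rintro ⟨p, h, h'⟩
    change M.preMul ⟨n, x p.1, t p.1⟩ ⟨m, y p.1, s p.1⟩ =
      M.val i.2.1 i.2.2 (x p.1) (y p.1) p.2
    rw [← h, ← h']
    exact M.preMul_eq _ _ _ _ _
  refine Continuous.congr ?_ fun p => (h1 p).symm
  refine continuous_mk ?_ (by fun_prop)
  refine (kcont_iff _).1 (M.kcont _) (S i) (fun p => (A.map i.2.1.op (x p.1.1),
    B.map i.2.2.op (y p.1.1))) (Continuous.prodMk ?_ ?_)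
  · exact (A.map i.2.1.op).hom.continuous.comp (by fun_prop)
  · exact (B.map i.2.2.op).hom.continuous.comp (by fun_prop)

theorem rmul_kcont [∀ n, IsGeneratedBy KH.{u} (A.obj n)] [∀ n, IsGeneratedBy KH.{u} (B.obj n)] :
    KCont.{u} fun p : GReal A × GReal B => M.rmul p.1 p.2 := by
  refine (kcont_iff _).2 fun K' _ _ _ ab hab => ?_
  have h1 : ∀ (m : SimplexCategory) (K : Type u) [TopologicalSpace K] [CompactSpace K] [T2Space K]
      (y : K → B.obj (op m)) (s : K → Simp m), Continuous y → Continuous s →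
      Continuous fun p : GReal A × K => M.rmul p.1 (GReal.mk m (y p.2) (s p.2)) := by
    intro m K _ _ _ y s hy hs
    refine continuous_real_prod _ fun n K₁ _ _ _ x hx => ?_
    exact M.continuous_preMul (K := K₁ × (Simp n × K)) (x := fun p => x p.1) (t := fun p => p.2.1)
      (y := fun p => y p.2.2) (s := fun p => s p.2.2) (by fun_prop) (by fun_prop) (by fun_prop)
      (by fun_prop)
  have h2 : Continuous fun p : GReal B × K' => M.rmul (ab p.2).1 p.1 := by
    refine continuous_real_prod _ fun m K _ _ _ y hy => ?_
    exact (h1 m (K × Simp m) (fun p => y p.1) (fun p => p.2) (by fun_prop) (by fun_prop)).comp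
      (f := fun p : K × (Simp m × K') => ((ab p.2.2).1, (p.1, p.2.1))) (by fun_prop)
  exact h2.comp (f := fun k => ((ab k).2, k)) (by fun_prop)

end LevelMul

end EHI

namespace EHI

/-! ### Topological monoids and their classifying spaces -/

/-- A topological monoid (a monoid object in compactly generated spaces). -/
structure KMonoid where
  carrier : Type u
  [top : TopologicalSpace carrier]
  [mon : Monoid carrier]
  mul_kcont : KCont.{u} fun p : carrier × carrier => p.1 * p.2

attribute [instance] KMonoid.top KMonoid.mon

section Bar

variable {M : Type u} [Monoid M] {n k : ℕ}

/-- The product `m_{a+1} ⋯ m_b` of consecutive elements of `(m_1, …, m_n)` (which are indexed by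
`0, …, n - 1` here). -/
def iprod (m : Fin n → M) (a b : ℕ) : M :=
  ((List.range' a (b - a)).map fun j => if h : j < n then m ⟨j, h⟩ else 1).prod

theorem iprod_self (m : Fin n → M) (a : ℕ) : iprod m a a = 1 := by simp [iprod]

theorem iprod_mul (m : Fin n → M) {a b c : ℕ} (h : a ≤ b) (h' : b ≤ c) :
    iprod m a b * iprod m b c = iprod m a c := by
  have h1 : List.range' a (c - a) = List.range' a (b - a) ++ List.range' b (c - b) := by
    have := List.range'_append_1 (s := a) (m := b - a) (n := c - b)
    rw [show a + (b - a) = b by omega, show b - a + (c - b) = c - a by omega] at this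
    exact this.symm
  rw [iprod, iprod, iprod, h1, List.map_append, List.prod_append]

theorem map_iprod {N F : Type*} [Monoid N] [FunLike F M N] [MonoidHomClass F M N] (f : F)
    (m : Fin n → M) (a b : ℕ) : f (iprod m a b) = iprod (fun i => f (m i)) a b := by
  rw [iprod, iprod, map_list_prod, List.map_map]
  congr 2
  funext j
  simp only [Function.comp]
  split_ifs <;> simp

theorem iprod_succ (m : Fin n → M) (i : Fin n) : iprod m i (i + 1) = m i := by
  simp [iprod]

/-- The structure maps of the bar construction: `(m_1, …, m_n)` is sent to the family with entries
`m_{f(i-1)+1} ⋯ m_{f(i)}` for `1 ≤ i ≤ k`. -/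
def barFun (f : Fin (k + 1) →o Fin (n + 1)) (m : Fin n → M) : Fin k → M :=
  fun i => iprod m (f i.castSucc) (f i.succ)

theorem iprod_barFun (f : Fin (k + 1) →o Fin (n + 1)) (m : Fin n → M) (a b : Fin (k + 1))
    (h : a ≤ b) : iprod (barFun f m) a b = iprod m (f a) (f b) := by
  induction b using Fin.induction with
  | zero =>
    obtain rfl : a = 0 := le_antisymm h (Fin.zero_le _)
    rw [iprod_self, iprod_self]
  | succ b ih =>
    rcases h.eq_or_lt with rfl | h
    · rw [iprod_self, iprod_self]
    have hb : a ≤ b.castSucc := Fin.le_castSucc_iff.2 h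
    have h1 := iprod_succ (barFun f m) b
    rw [← iprod_mul (barFun f m) (a := a) (b := b) (Fin.le_def.1 hb) (by simp), Fin.val_succ, h1]
    refine (congrArg (· * _) (ih hb)).trans ?_
    exact iprod_mul m (Fin.le_def.1 (f.monotone hb))
      (Fin.le_def.1 (f.monotone (Fin.castSucc_lt_succ (i := b)).le))

end Bar

namespace KMonoid

theorem kcont_list_prod (M : KMonoid.{u}) {n : ℕ} (L : List ℕ) :
    KCont.{u} fun m : Fin n → M.carrier =>
      (L.map fun j => if h : j < n then m ⟨j, h⟩ else 1).prod := by
  refine (kcont_iff _).2 fun K _ _ _ g hg => ?_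
  induction L with
  | nil => exact continuous_const
  | cons j L ih =>
    simp only [List.map_cons, List.prod_cons]
    have h1 : Continuous fun k => if h : j < n then g k ⟨j, h⟩ else 1 := by
      by_cases h : j < n
      · simp only [dif_pos h]
        exact (continuous_apply (⟨j, h⟩ : Fin n)).comp hg
      · simp only [dif_neg h]
        exact continuous_const
    exact (kcont_iff _).1 M.mul_kcont K (fun k => (_, _)) (h1.prodMk ih)

/-- The compactly generated product `M^n`. -/
def Pow (M : KMonoid.{u}) (n : ℕ) : Type u := Fin n → M.carrier

instance (M : KMonoid.{u}) (n : ℕ) : TopologicalSpace (M.Pow n) :=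
  kTop (Fin n → M.carrier) Pi.topologicalSpace

theorem Pow_continuous {M N : KMonoid.{u}} {n k : ℕ}
    {f : (Fin n → M.carrier) → (Fin k → N.carrier)}
    (hf : KCont.{u} f) : @Continuous (M.Pow n) (N.Pow k) _ _ f :=
  (kTop_continuous_kTop_iff _ _ _).2 hf

/-- The bar construction of a topological monoid, a simplicial space with `n`-simplices `M^n`. -/
def bar (M : KMonoid.{u}) : SimplicialObject TopCat.{u} where
  obj n := TopCat.of (M.Pow n.unop.len)
  map {n k} f := TopCat.ofHom (X := M.Pow n.unop.len) (Y := M.Pow k.unop.len)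
    ⟨barFun f.unop.toOrderHom, Pow_continuous ((kcont_iff _).2 fun K _ _ _ g hg =>
      continuous_pi fun i => (kcont_iff _).1 (M.kcont_list_prod _) K g hg)⟩
  map_id n := by
    refine TopCat.hom_ext (ContinuousMap.ext fun m => funext fun i => ?_)
    exact iprod_succ m i
  map_comp f g := by
    refine TopCat.hom_ext (ContinuousMap.ext fun m => funext fun i => ?_)
    exact (iprod_barFun f.unop.toOrderHom m _ _
      (g.unop.toOrderHom.monotone (Fin.castSucc_lt_succ (i := i)).le)).symm

/-- The classifying space `B M` of a topological monoid. -/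
def B (M : KMonoid.{u}) : TopCat.{u} := realization.obj M.bar

/-- The map of bar constructions induced by a continuous homomorphism. -/
def barMap {M N : KMonoid.{u}} (f : M.carrier →ₜ* N.carrier) : M.bar ⟶ N.bar where
  app n := TopCat.ofHom (X := M.Pow n.unop.len) (Y := N.Pow n.unop.len)
    ⟨fun m i => f (m i), Pow_continuous (Continuous.continuousGeneratedBy
      (continuous_pi fun i => f.continuous_toFun.comp (continuous_apply i)))⟩
  naturality n k g := by
    refine TopCat.hom_ext (ContinuousMap.ext fun m => funext fun i => ?_)
    exact map_iprod f m _ _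

/-- The map of classifying spaces induced by a continuous homomorphism. -/
def BMap {M N : KMonoid.{u}} (f : M.carrier →ₜ* N.carrier) : M.B ⟶ N.B :=
  realization.map (barMap f)

/-- The structure map `M × I → B M`, sending `(x, s)` to the point with coordinates `(1 - s, s)` of
the edge `x`; its adjoint is the map `M → Ω B M`. -/
def bond (M : KMonoid.{u}) (x : M.carrier) (s : unitInterval) : M.B :=
  GReal.mk (Y := M.bar) (SimplexCategory.mk 1) (fun _ => x) (edge s)

end KMonoid

end EHI

namespace EHI

/-! ### The topological monoid `X_{h𝓘}` -/

namespace IMonoid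

variable (X : IMonoid.{u})

/-- The diagram of spaces underlying an `𝓘`-monoid. -/
def diag : ICat ⥤ TopCat.{u} where
  obj n := TopCat.of (X.obj n.card)
  map α := TopCat.ofHom ⟨X.map (ICat.emb α), X.map_continuous _⟩
  map_id n := TopCat.hom_ext (ContinuousMap.ext fun x => X.map_id x)
  map_comp α β := TopCat.hom_ext (ContinuousMap.ext fun x => X.map_comp _ _ x)

/-- The homotopy colimit `X_{h𝓘}`. -/
abbrev hI : TopCat.{u} := hocolim X.diag

/-- The point of `X_{h𝓘}` which is represented by a chain `c₀ → ⋯ → c_p` in `𝓘`, an element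
of `X(c₀)` and a point of the `p`-simplex. -/
def hmk (p : SimplexCategory) (c : Fin (p.len + 1) ⥤ ICat) (x : X.obj (c.obj 0).card)
    (t : Simp p) : X.hI :=
  GReal.mk (Y := srep X.diag) p ⟨c, x⟩ t

end IMonoid

theorem addEmb_refl (m n : ℕ) :
    addEmb (Function.Embedding.refl (Fin m)) (Function.Embedding.refl (Fin n)) =
      Function.Embedding.refl _ := by
  ext j
  obtain ⟨j, rfl⟩ := finSumFinEquiv.surjective j
  rcases j with j | j <;> simp [addEmb]

theorem addEmb_trans {l m n l' m' n' : ℕ} (α : Fin l ↪ Fin m) (β : Fin m ↪ Fin n)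
    (α' : Fin l' ↪ Fin m') (β' : Fin m' ↪ Fin n') :
    addEmb (α.trans β) (α'.trans β') = (addEmb α α').trans (addEmb β β') := by
  ext j
  obtain ⟨j, rfl⟩ := finSumFinEquiv.surjective j
  rcases j with j | j <;> simp [addEmb]

theorem addEmb_inl {m n m' n' : ℕ} (α : Fin m ↪ Fin m') (β : Fin n ↪ Fin n') (j : Fin m) :
    addEmb α β (finSumFinEquiv (Sum.inl j)) = finSumFinEquiv (Sum.inl (α j)) := by
  simp [addEmb]

theorem addEmb_inr {m n m' n' : ℕ} (α : Fin m ↪ Fin m') (β : Fin n ↪ Fin n') (j : Fin n) :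
    addEmb α β (finSumFinEquiv (Sum.inr j)) = finSumFinEquiv (Sum.inr (β j)) := by
  simp [addEmb]

theorem zero_addEmb {n n' : ℕ} (α : Fin 0 ↪ Fin 0) (β : Fin n ↪ Fin n') :
    (addEmb α β).trans (castEmb (Nat.zero_add n')) = (castEmb (Nat.zero_add n)).trans β := by
  have h : ∀ {n : ℕ} (j : Fin n),
      castEmb (Nat.zero_add n) (finSumFinEquiv (m := 0) (Sum.inr j)) = j := fun j =>
    Fin.ext (by simp [castEmb])
  refine DFunLike.ext _ _ fun j => ?_
  obtain ⟨j, rfl⟩ := finSumFinEquiv.surjective j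
  rcases j with j | j
  · exact j.elim0
  · rw [Function.Embedding.trans_apply, Function.Embedding.trans_apply, addEmb_inr, h, h]

theorem addEmb_zero {n n' : ℕ} (α : Fin 0 ↪ Fin 0) (β : Fin n ↪ Fin n') :
    (addEmb β α).trans (castEmb (Nat.add_zero n')) = (castEmb (Nat.add_zero n)).trans β := by
  have h : ∀ {n : ℕ} (j : Fin n),
      castEmb (Nat.add_zero n) (finSumFinEquiv (n := 0) (Sum.inl j)) = j := fun j => rfl
  refine DFunLike.ext _ _ fun j => ?_
  obtain ⟨j, rfl⟩ := finSumFinEquiv.surjective j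
  rcases j with j | j
  · rw [Function.Embedding.trans_apply, Function.Embedding.trans_apply, addEmb_inl, h, h]
  · exact j.elim0

theorem addEmb_assoc {l m n l' m' n' : ℕ} (α : Fin l ↪ Fin l') (β : Fin m ↪ Fin m')
    (γ : Fin n ↪ Fin n') :
    (addEmb (addEmb α β) γ).trans (castEmb (Nat.add_assoc l' m' n')) =
      (castEmb (Nat.add_assoc l m n)).trans (addEmb α (addEmb β γ)) := by
  ext j
  obtain ⟨j, rfl⟩ := finSumFinEquiv.surjective j
  rcases j with j | j
  · obtain ⟨j, rfl⟩ := finSumFinEquiv.surjective j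
    rcases j with j | j
    · have : castEmb (Nat.add_assoc l m n) (finSumFinEquiv (Sum.inl (finSumFinEquiv (Sum.inl j))))
          = finSumFinEquiv (Sum.inl j) := by ext; simp [castEmb]
      simp only [Function.Embedding.trans_apply, addEmb, this]
      simp [castEmb]
    · have : castEmb (Nat.add_assoc l m n) (finSumFinEquiv (Sum.inl (finSumFinEquiv (Sum.inr j))))
          = finSumFinEquiv (Sum.inr (finSumFinEquiv (Sum.inl j))) := by ext; simp [castEmb]
      simp only [Function.Embedding.trans_apply, addEmb, this]
      simp [castEmb]
  · have : castEmb (Nat.add_assoc l m n) (finSumFinEquiv (Sum.inr j))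
        = finSumFinEquiv (Sum.inr (finSumFinEquiv (Sum.inr j))) := by
      ext; simp [castEmb, Nat.add_assoc]
    simp only [Function.Embedding.trans_apply, addEmb, this]
    simp [castEmb, Nat.add_assoc]

/-- The concatenation `c ⊔ d` of two diagrams in `𝓘`. -/
def oplus {P : Type} [Preorder P] (c d : P ⥤ ICat) : P ⥤ ICat where
  obj i := ⟨(c.obj i).card + (d.obj i).card⟩
  map f := addEmb (ICat.emb (c.map f)) (ICat.emb (d.map f))
  map_id i := by
    rw [c.map_id, d.map_id]
    exact addEmb_refl _ _
  map_comp f g := by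
    rw [c.map_comp, d.map_comp]
    exact addEmb_trans _ _ _ _

theorem kcont_of_clopen {W : Type v} {Z : Type w} {ι : Type u} [TopologicalSpace W]
    [TopologicalSpace Z] {f : W → Z} (q : W → ι) (hq : ∀ i, IsClopen {a | q a = i})
    (hf : ∀ (i : ι) (K : Type u) [TopologicalSpace K] [CompactSpace K] [T2Space K] (g : K → W),
      Continuous g → (∀ k, q (g k) = i) → Continuous fun k => f (g k)) : KCont.{u} f := by
  refine (kcont_iff _).2 fun K _ _ _ g hg => continuous_iff_continuousAt.2 fun k => ?_
  have hU : IsClopen {a | q (g a) = q (g k)} := (hq (q (g k))).preimage hg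
  have : CompactSpace {a | q (g a) = q (g k)} := isCompact_iff_compactSpace.1 hU.1.isCompact
  have h : ContinuousOn (fun k => f (g k)) {a | q (g a) = q (g k)} :=
    continuousOn_iff_continuous_domRestrict.2 (hf (q (g k)) _ (fun (a : {a | q (g a) = q (g k)}) => g a.1)
      (hg.comp continuous_subtype_val) fun a => a.2)
  exact h.continuousAt (hU.2.mem_nhds rfl)

theorem isClopen_fst_eq {ι : Type w} {Y : ι → Type u} [∀ i, TopologicalSpace (Y i)] (i : ι) :
    IsClopen {a : Sigma Y | a.1 = i} := by
  have h : {a : Sigma Y | a.1 = i} = Set.range (Sigma.mk i) := by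
    ext ⟨j, y⟩
    constructor
    · rintro rfl
      exact ⟨y, rfl⟩
    · rintro ⟨z, hz⟩
      exact (congrArg Sigma.fst hz).symm
  rw [h]
  exact isClopen_range_sigmaMk

theorem sigma_lift {K : Type v} [TopologicalSpace K] {ι : Type w} {Y : ι → Type u}
    [∀ i, TopologicalSpace (Y i)] {g : K → Sigma Y} (hg : Continuous g) (i : ι)
    (h : ∀ k, (g k).1 = i) : ∃ x : K → Y i, Continuous x ∧ ∀ k, g k = ⟨i, x k⟩ := by
  have h1 : ∀ k, ∃ y : Y i, g k = ⟨i, y⟩ := fun k => by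
    rcases hk : g k with ⟨j, y⟩
    have := h k
    rw [hk] at this
    obtain rfl : j = i := this
    exact ⟨y, rfl⟩
  choose x hx using h1
  refine ⟨x, Topology.IsEmbedding.sigmaMk.continuous_iff.2 (hg.congr hx), hx⟩

namespace IMonoid

variable (X : IMonoid.{u})

instance (p : SimplexCategoryᵒᵖ) : IsGeneratedBy KH.{u} ((srep X.diag).obj p) :=
  inferInstanceAs (IsGeneratedBy KH.{u} (Σ c : Fin (p.unop.len + 1) ⥤ ICat, X.obj (c.obj 0).card))

/-- The multiplication on the nerve of the transport category of an `𝓘`-monoid, given by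
concatenation of chains and the multiplications of `X`. -/
def levelMul : LevelMul (srep X.diag) (srep X.diag) (srep X.diag) where
  mul p x y := ⟨oplus x.1 y.1, X.mul x.2 y.2⟩
  natural {m n} f x y := by
    refine congrArg (Sigma.mk (β := fun c : Fin (m.len + 1) ⥤ ICat => X.diag.obj (c.obj 0)) _) ?_
    exact (X.mul_natural _ _ _ _).symm
  kcont p := by
    refine kcont_of_clopen (ι := ULift.{u} ((Fin (p.len + 1) ⥤ ICat) × (Fin (p.len + 1) ⥤ ICat)))
      (fun q => ⟨q.1.1, q.2.1⟩) ?_ ?_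
    · rintro ⟨c, d⟩
      have h : ∀ c, IsClopen {a : (srep X.diag).obj (op p) | a.1 = c} := fun c => isClopen_fst_eq c
      refine (congrArg IsClopen (Set.ext fun a => ?_)).mp
        (((h c).preimage continuous_fst).inter ((h d).preimage continuous_snd))
      exact ⟨fun h => congrArg ULift.up (Prod.ext h.1 h.2),
        fun h => Prod.mk.inj (ULift.up.inj h)⟩
    · rintro ⟨c, d⟩ K _ _ _ g hg h
      obtain ⟨x, hx, hx'⟩ := sigma_lift hg.fst c fun k => congrArg (fun z => z.down.1) (h k)
      obtain ⟨y, hy, hy'⟩ := sigma_lift hg.snd d fun k => congrArg (fun z => z.down.2) (h k)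
      have h1 : Continuous fun k => X.mul (x k) (y k) :=
        (kcont_iff _).1 (X.mul_continuous _ _) K (fun k => (x k, y k)) (hx.prodMk hy)
      refine Continuous.congr (f := fun k => (⟨oplus c d, X.mul (x k) (y k)⟩ :
        Σ c : Fin (p.len + 1) ⥤ ICat, X.obj (c.obj 0).card)) (continuous_sigmaMk.comp h1) fun k => ?_
      change _ = (⟨oplus (g k).1.1 (g k).2.1, X.mul (g k).1.2 (g k).2.2⟩ :
        Σ c : Fin (p.len + 1) ⥤ ICat, X.obj (c.obj 0).card)
      rw [hx', hy']

theorem srep_ext {p : SimplexCategory} {c c' : Fin (p.len + 1) ⥤ ICat} {x : X.obj (c.obj 0).card}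
    {x' : X.obj (c'.obj 0).card} (e : ∀ i, (c.obj i).card = (c'.obj i).card)
    (h : ∀ {i j} (f : i ⟶ j), (ICat.emb (c.map f)).trans (castEmb (e j)) =
      (castEmb (e i)).trans (ICat.emb (c'.map f)))
    (hx : X.map (castEmb (e 0)) x = x') (t : Simp p) : X.hmk p c x t = X.hmk p c' x' t := by
  obtain ⟨o, a, h1, h2⟩ := c
  obtain ⟨o', a', h1', h2'⟩ := c'
  obtain rfl : o = o' := funext fun i => congrArg ICat.mk (e i)
  obtain rfl : @a = @a' := by
    funext i j f
    exact h f
  obtain rfl : x = x' := (X.map_id x).symm.trans hx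
  rfl

/-- The neutral element of `X_{h𝓘}`. -/
noncomputable def hone : X.hI :=
  X.hmk (SimplexCategory.mk 0) ((Functor.const _).obj ⟨0⟩) (X.pt 0) (stdSimplex.vertex 0)

theorem hone_eq (p : SimplexCategory) (t : Simp p) :
    X.hone = X.hmk p ((Functor.const _).obj ⟨0⟩) (X.pt 0) t := by
  have f : p ⟶ SimplexCategory.mk 0 := SimplexCategory.const _ _ 0
  have h := LevelMul.mk_map (A := srep X.diag) f
    ⟨(Functor.const _).obj ⟨0⟩, X.pt 0⟩ t
  have ht : stdSimplex.map f.toOrderHom t = (stdSimplex.vertex 0 : Simp (SimplexCategory.mk 0)) :=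
    Subsingleton.elim (α := stdSimplex ℝ (Fin 1)) _ _
  rw [ht] at h
  refine h.symm.trans ?_
  exact congrArg (fun y => X.hmk p ((Functor.const _).obj ⟨0⟩) y t) (X.map_id _)

/-- The product on `X_{h𝓘}`. -/
noncomputable def hmul : X.hI → X.hI → X.hI := X.levelMul.rmul

theorem hmul_hmk (p : SimplexCategory) (c d : Fin (p.len + 1) ⥤ ICat) (x : X.obj (c.obj 0).card)
    (y : X.obj (d.obj 0).card) (t : Simp p) :
    X.hmul (X.hmk p c x t) (X.hmk p d y t) = X.hmk p (oplus c d) (X.mul x y) t :=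
  X.levelMul.rmul_mk p ⟨c, x⟩ ⟨d, y⟩ t

theorem exists_hmk (a : X.hI) : ∃ (p : SimplexCategory) (c : Fin (p.len + 1) ⥤ ICat)
    (x : X.obj (c.obj 0).card) (t : Simp p), a = X.hmk p c x t := by
  obtain ⟨p, ⟨c, x⟩, t, rfl⟩ := exists_mk a
  exact ⟨p, c, x, t, rfl⟩

theorem exists_hmk₃ (a b d : X.hI) : ∃ (p : SimplexCategory) (c₁ c₂ c₃ : Fin (p.len + 1) ⥤ ICat)
    (x : X.obj (c₁.obj 0).card) (y : X.obj (c₂.obj 0).card) (z : X.obj (c₃.obj 0).card)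
    (t : Simp p), a = X.hmk p c₁ x t ∧ b = X.hmk p c₂ y t ∧ d = X.hmk p c₃ z t := by
  obtain ⟨p, ⟨c₁, x⟩, ⟨c₂, y⟩, ⟨c₃, z⟩, t, rfl, rfl, rfl⟩ := exists_mk₃ a b d
  exact ⟨p, c₁, c₂, c₃, x, y, z, t, rfl, rfl, rfl⟩

theorem hone_hmul (a : X.hI) : X.hmul X.hone a = a := by
  obtain ⟨p, c, x, t, rfl⟩ := X.exists_hmk a
  rw [X.hone_eq p t]
  refine (X.hmul_hmk p _ c _ x t).trans (X.srep_ext (fun i => Nat.zero_add _) (fun {i j} f => ?_)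
    (X.one_mul x) t)
  exact zero_addEmb _ _

theorem hmul_hone (a : X.hI) : X.hmul a X.hone = a := by
  obtain ⟨p, c, x, t, rfl⟩ := X.exists_hmk a
  rw [X.hone_eq p t]
  refine (X.hmul_hmk p c _ x _ t).trans (X.srep_ext
    (c := oplus c ((Functor.const _).obj ⟨0⟩)) (fun i => Nat.add_zero _) (fun {i j} f => ?_)
    (X.mul_one x) t)
  exact addEmb_zero _ _

theorem hmul_assoc (a b d : X.hI) : X.hmul (X.hmul a b) d = X.hmul a (X.hmul b d) := by
  obtain ⟨p, c₁, c₂, c₃, x, y, z, t, rfl, rfl, rfl⟩ := X.exists_hmk₃ a b d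
  rw [hmul_hmk, hmul_hmk]
  refine (X.hmul_hmk p (oplus c₁ c₂) c₃ (X.mul x y) z t).trans (Eq.trans ?_
    (X.hmul_hmk p c₁ (oplus c₂ c₃) x (X.mul y z) t).symm)
  refine (X.srep_ext (fun i => Nat.add_assoc _ _ _) (fun {i j} f => ?_) (X.mul_assoc x y z) t)
  exact addEmb_assoc _ _ _

/-- The topological monoid `(X_{h𝓘}, μ)`: the product of the points represented by `(c, x, t)` and
`(d, y, t)` is represented by `(c ⊔ d, μ(x, y), t)`. -/
noncomputable def hMonoid : KMonoid.{u} where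
  carrier := X.hI
  mon :=
    { mul := X.hmul
      one := X.hone
      mul_assoc := X.hmul_assoc
      one_mul := X.hone_hmul
      mul_one := X.hmul_hone }
  mul_kcont := X.levelMul.rmul_kcont

end IMonoid

/-- The map of homotopy colimits induced by a morphism of `𝓘`-monoids. -/
def IMonoidHom.hMap {X Y : IMonoid.{u}} (ψ : IMonoidHom X Y) : X.hI ⟶ Y.hI :=
  realization.map (srepMap (F := X.diag) (F' := Y.diag) (𝟭 _)
    { app n := TopCat.ofHom ⟨ψ.app n.card, ψ.continuous n.card⟩
      naturality _ _ α := TopCat.hom_ext (ContinuousMap.ext fun x => ψ.naturality _ x) })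

/-- The topological monoid `GL₁(R) = gl₁(R)_{h𝓘}`. -/
noncomputable def CommSymRingSpectrum.GL1 (R : CommSymRingSpectrum.{u}) : KMonoid.{u} :=
  R.gl1.toIMonoid.hMonoid

end EHI

open EHI

/-! The morphism `φ` is the orbit map of the unit: `g ∈ G(n)` goes to the loop `t ↦ g · η_n(t)`.
That it is a morphism of `𝓘`-monoids is a direct translation of the axioms of an action. The
identity of the group gives the base point `η_n`. Since `η_{m+n}` is the product of `η_m` and `η_n`,
axiom (ii) turns `μ(g, h) · η_{m+n}` into the product of the two orbit loops (`orbit_mu`). For an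
injection `α`, write `α = ᾱ ∘ ι` with `ι` the inclusion onto the last letters and `ᾱ` a bijection:
axiom (iii) handles `ι` and equivariance handles `ᾱ`, and together they reproduce exactly the
formula by which `α` acts on `Ω^∞(R)` (`orbit_map`).

The factorization over the units rests on the Eckmann–Hilton identity `μ(g, h) = μ(g, 1) · μ(1, h)`,
in which the two factors are the stabilizations of `g` and `h` to the left and right block
(`mu_eq_mul`). For `h = g⁻¹`, compatible inverses provide a path that moves the left stabilization
of `g` to the right one. There it meets the right stabilization of `g⁻¹`, and the product of the two
is the image of `g g⁻¹ = 1` under a homomorphism. Hence `μ(g, g⁻¹)` lies in the path component of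
the base point (`joined_mu_inv`). Replacing `g` by `g⁻¹` gives the other order, so every element of
`G` has a stable inverse. A morphism of `𝓘`-monoids preserves products, base points and paths, hence
also stable inverses, and so `φ` takes values in `gl_1(R)`.

The deloopings are then formal. `Γ` and `B_μ` are built from functorial operations (products over
`D(S)`, nerves of transport categories, realization), and a morphism of commutative `𝓘`-monoids
respects the products that define the `Γ`-structure (`map_mulU`); that `G` is commutative is again
Eckmann–Hilton (`EHIGroup.mu_comm`). Compatibility with the structure maps is naturality of `Γ(ψ)`
at the isomorphism `S ≅ [1] ∧ S`.

On homotopy colimits the map is a homomorphism because any two points can be represented over the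
same point of one simplex (`exists_mk₂`), where the product is given by concatenating chains and
applying `μ`. The bar construction then takes this continuous homomorphism to a map of classifying
spaces, which sends the edge `x` to the edge `f x`. -/

namespace EHI

/-! ### The orbit map of the unit as a morphism of `𝓘`-monoids -/

namespace EHIAction

variable {G : EHIGroup.{u}} {R : CommSymRingSpectrum.{u}} (a : EHIAction G R)

/-- Equivariance of the action for bijections between the sets `{1, …, m}` and `{1, …, n}`. -/
theorem act_κ {m n : ℕ} (σ : Fin m ≃ Fin n) (g : G.obj m) (x : R.obj m) :
    R.act σ (a.κ m g x) = a.κ n (G.map σ.toEmbedding g) (R.act σ x) := by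
  -- A bijection forces `m = n`, so `σ` becomes a permutation and the equivariance axiom applies.
  -- The two-index form is needed for `barEquiv α`, whose source has `n - m + m` elements, a number
  -- not definitionally equal to `n`.
  obtain rfl : m = n := Fin.equiv_iff_eq.1 ⟨σ⟩
  exact (a.equivariant m σ g x).symm

/-- The orbit map `g ↦ g · η_n`. -/
def orbit (n : ℕ) (g : G.obj n) : R.Loops n :=
  ⟨⟨fun t => a.κ n g (R.eta n t),
    -- The action is only assumed continuous for the compactly generated product topology; this
    -- suffices because the cube is compact Hausdorff.
    kcont_comp (a.continuous n) (g := fun t => (g, R.eta n t))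
      (continuous_const.prodMk (R.eta n).1.continuous)⟩, fun t ht =>
    -- On the boundary of the cube `η_n` takes the base point as value, and the action fixes it, so
    -- the orbit is again a pointed map on `S^n`.
    (congrArg (a.κ n g) ((R.eta n).2 t ht)).trans (a.act_pt n g)⟩

theorem orbit_apply (n : ℕ) (g : G.obj n) (t : Fin n → unitInterval) :
    a.orbit n g t = a.κ n g (R.eta n t) := rfl

/-- By the exponential law this reduces to joint continuity in the group element and the cube
coordinate. The target carries the compact-open topology here; its compactly generated refinement is
dealt with in `toOmega`. -/
theorem orbit_continuous (n : ℕ) : Continuous (a.orbit n) := by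
  -- `G(n)` is compactly generated, so a compact Hausdorff test space `K` may replace it. Then `K ×
  -- I^n` is again compact Hausdorff, and this is what makes the continuity hypothesis on `κ_n`
  -- applicable.
  refine (IsGeneratedBy.continuous_iff KH.{u} _).2 fun K x => ?_
  refine CommSymRingSpectrum.continuous_loops (K := KH K) _ ?_
  exact (kcont_iff _).1 (a.continuous n) (KH K × (Fin n → unitInterval))
    (fun p => (x p.1, R.eta n p.2))
    ((x.continuous.comp continuous_fst).prodMk ((R.eta n).1.continuous.comp continuous_snd))

theorem orbit_one (n : ℕ) : a.orbit n 1 = R.eta n :=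
  GenLoop.ext _ _ fun _ => a.one_act n _

/-- Axiom (ii) of an action, evaluated at `η_m(s)` and `η_n(t)`, whose product is `η_{m+n}(s, t)`.
-/
theorem orbit_mu {m n : ℕ} (g : G.obj m) (h : G.obj n) :
    a.orbit (m + n) (G.mu g h) = CommSymRingSpectrum.loopMul (a.orbit m g) (a.orbit n h) := by
  refine GenLoop.ext _ _ fun t => ?_
  rw [CommSymRingSpectrum.loopMul_apply, orbit_apply, orbit_apply, orbit_apply, ← a.mu_act,
    R.mu_eta]
  -- A point of the cube `I^{m+n}` is recovered by appending its last `n` coordinates to its first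
  -- `m`.
  exact congrArg (fun s => a.κ _ _ (R.eta _ s)) Fin.append_castAdd_natAdd.symm

/-- The stabilization axiom covers the standard inclusion onto the last `m` letters and equivariance
covers bijections. Every injection is the composite of one of each, and `Ω^∞(R)` is made functorial
through the same factorization. -/
theorem orbit_map {m n : ℕ} (α : Fin m ↪ Fin n) (g : G.obj m) :
    a.orbit n (G.map α g) = CommSymRingSpectrum.loopAct (barEquiv α)
      (CommSymRingSpectrum.loopMul (R.eta (n - m)) (a.orbit m g)) := by
  -- The factorization `α = ᾱ ∘ ι`: by construction `ᾱ` agrees with `α` on the last `m` letters.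
  have hα : (Fin.natAddEmb (n - m)).trans (barEquiv α).toEmbedding = α :=
    DFunLike.ext _ _ (barEquiv_natAdd α)
  refine GenLoop.ext _ _ fun t => ?_
  -- The right-hand side is rewritten from the inside out: `η_l · (g · η_m)` becomes `ι_*g · (η_l ·
  -- η_m)` by stabilization, then `ᾱ` is moved past the action by equivariance, turning `ι_*g` into
  -- `α_*g`. The products of units are merged, and `ᾱ` finally acts on `η` by permuting coordinates.
  rw [CommSymRingSpectrum.loopAct_apply, CommSymRingSpectrum.loopMul_apply, orbit_apply,
    orbit_apply, ← a.stabilization, act_κ, ← G.map_comp, hα, R.mu_eta, R.eta_equivariant]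
  refine congrArg (fun s => a.κ n (G.map α g) (R.eta n s)) (funext fun i => ?_)
  -- Only the coordinates remain to be compared: precomposing with `ᾱ`, splitting into two blocks,
  -- appending them and precomposing with `ᾱ⁻¹` changes nothing. This is checked at the indices
  -- `ᾱ(j)`.
  obtain ⟨j, rfl⟩ := (barEquiv α).surjective i
  simp only [Function.comp_apply, Equiv.symm_apply_apply]
  exact (congrFun (Fin.append_castAdd_natAdd (f := t ∘ barEquiv α)) j).symm

/-- The morphism of `𝓘`-monoids `G → Ω^∞(R)`, `g ↦ g · η_n`. -/
noncomputable def toOmega : IMonoidHom G.toIMonoid R.Omega.toIMonoid where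
  app := a.orbit
  -- Refining the topology of the loop space to the compactly generated one does not affect
  -- continuity of maps out of the compactly generated space `G(n)`.
  continuous n := (@continuous_kTop_iff (R.Loops n) (G.obj n) _ _ inferInstance (a.orbit n)).2
    (a.orbit_continuous n)
  app_pt := a.orbit_one
  naturality := a.orbit_map
  app_mul := a.orbit_mu

end EHIAction

/-! ### Stable inverses from compatible inverses -/

namespace EHIGroup

variable {G : EHIGroup.{u}}

/-- Paths are multiplied pointwise. The unit interval is compact Hausdorff, so continuity of the
group multiplication on the compactly generated product is enough. -/
theorem joined_mul {n : ℕ} {g g' h h' : G.obj n} (hg : Joined g g') (hh : Joined h h') :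
    Joined (g * h) (g' * h') := by
  obtain ⟨p⟩ := hg
  obtain ⟨q⟩ := hh
  exact ⟨⟨⟨fun t => p t * q t, kcont_comp (G.nu_continuous n) (g := fun t => (p t, q t))
    (by fun_prop)⟩, by simp, by simp⟩⟩

/-- Eckmann–Hilton: apply the interchange law to `g = g · 1` and `h = 1 · h`. The monoid
multiplication is thereby expressed through the group structure and the two block inclusions, so
that paths between stabilizations can be used to deform products. -/
theorem mu_eq_mul {m n : ℕ} (g : G.obj m) (h : G.obj n) :
    G.mu g h = G.map (Fin.castAddEmb n) g * G.map (Fin.natAddEmb m) h := by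
  rw [← mu_one_left, ← mu_one_right, ← G.interchange, mul_one, one_mul]

/-- In `μ(g, g⁻¹)` the two factors sit in different blocks and cannot cancel directly. The path
given by compatible inverses brings `g` into the block of `g⁻¹`, where they do. -/
theorem CompatibleInverses.joined_mu_inv (hG : G.CompatibleInverses) {n : ℕ} (g : G.obj n) :
    Joined (G.mu g g⁻¹) 1 := by
  -- The hypothesis runs from the right block to the left block, hence the reversal. The second
  -- factor, the right stabilization of `g⁻¹`, stays constant along the path.
  have h := joined_mul (hG n g).symm (Joined.refl (G.map (Fin.natAddEmb n) g⁻¹))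
  rwa [← mu_eq_mul, ← map_mul, mul_inv_cancel, map_one] at h

/-- If `G` has compatible inverses, then every element of `G` has a stable inverse. -/
theorem CompatibleInverses.hasStableInverse (hG : G.CompatibleInverses) {n : ℕ} (g : G.obj n) :
    G.toIMonoid.HasStableInverse g :=
  -- The group inverse in the same level `G(n)` is the stable inverse. The product in the opposite
  -- order is the same statement for `g⁻¹`, whose inverse is `g`.
  ⟨n, (g⁻¹ : G.obj n), hG.joined_mu_inv g,
    (congrArg (fun k => Joined (G.mu g⁻¹ k) 1) (inv_inv g)).mp (hG.joined_mu_inv g⁻¹)⟩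

end EHIGroup

/-! ### Factoring morphisms over the units -/

/-- The image of a stable inverse of `x` is a stable inverse of the image: a morphism is continuous,
so it carries the two paths along, and it preserves products and base points. -/
theorem IMonoidHom.hasStableInverse {X Y : IMonoid.{u}} (φ : IMonoidHom X Y) {n : ℕ} {x : X.obj n}
    (hx : X.HasStableInverse x) : Y.HasStableInverse (φ.app n x) := by
  obtain ⟨m, y, h1, h2⟩ := hx
  refine ⟨m, φ.app m y, ?_, ?_⟩
  · have h := h1.map (φ.continuous _)
    rwa [φ.app_mul, φ.app_pt] at h
  · have h := h2.map (φ.continuous _)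
    rwa [φ.app_mul, φ.app_pt] at h

/-- A morphism to a commutative `𝓘`-monoid with values in elements with a stable inverse factors
over the units. -/
def IMonoidHom.toUnits {X : IMonoid.{u}} {Y : CommIMonoid.{u}} (φ : IMonoidHom X Y.toIMonoid)
    (h : ∀ (n : ℕ) (x : X.obj n), Y.HasStableInverse (φ.app n x)) :
    IMonoidHom X Y.units.toIMonoid where
  app n x := ⟨φ.app n x, h n x⟩
  -- The units carry the compactly generated refinement of the subspace topology. As `X(n)` is
  -- compactly generated, continuity into the plain subspace suffices.
  continuous n := (continuous_kTop_iff (Z := X.obj n) _ _).2 ((φ.continuous n).subtype_mk _)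
  app_pt n := Subtype.ext (φ.app_pt n)
  naturality α x := Subtype.ext (φ.naturality α x)
  app_mul x y := Subtype.ext (φ.app_mul x y)

/-! ### The induced homomorphism on homotopy colimits -/

namespace IMonoidHom

variable {X Y : IMonoid.{u}} (ψ : IMonoidHom X Y)

theorem hMap_hmk (p : SimplexCategory) (c : Fin (p.len + 1) ⥤ ICat) (x : X.obj (c.obj 0).card)
    (t : Simp p) : ψ.hMap (X.hmk p c x t) = Y.hmk p c (ψ.app _ x) t := rfl

/-- The neutral element is represented by the base point of `X(0)` over the constant chain at `0`;
the chain is left unchanged and the base point is preserved. -/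
theorem hMap_hone : ψ.hMap X.hone = Y.hone :=
  (ψ.hMap_hmk _ _ _ _).trans (congrArg (fun y => Y.hmk _ _ y _) (ψ.app_pt 0))

/-- The product on the realization has an explicit formula only for points lying over a common
simplex coordinate. Once both points are so represented, the claim is multiplicativity of `ψ` at the
initial objects of the chains. -/
theorem hMap_hmul (a b : X.hI) : ψ.hMap (X.hmul a b) = Y.hmul (ψ.hMap a) (ψ.hMap b) := by
  -- Common representatives exist because two points of simplices are always images of one point of
  -- a third simplex under monotone maps (`exists_common`).
  obtain ⟨p, ⟨c, x⟩, ⟨d, y⟩, t, rfl, rfl⟩ := exists_mk₂ a b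
  refine (congrArg ψ.hMap (X.hmul_hmk p c d x y t)).trans (Eq.trans ?_
    (Y.hmul_hmk p c d (ψ.app _ x) (ψ.app _ y) t).symm)
  exact congrArg (fun z => Y.hmk p (oplus c d) z t) (ψ.app_mul x y)

/-- The continuous homomorphism `X_{h𝓘} → Y_{h𝓘}` induced by a morphism of `𝓘`-monoids. -/
noncomputable def hMonoidHom : X.hMonoid.carrier →ₜ* Y.hMonoid.carrier where
  toFun := ψ.hMap
  map_one' := ψ.hMap_hone
  map_mul' := ψ.hMap_hmul
  continuous_toFun := ψ.hMap.hom.continuous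

end IMonoidHom

/-! ### Compatibility of the deloopings with the structure maps -/

/-- The delooping of a map of `Γ`-spaces is compatible with the structure maps. -/
theorem Bmu_map_bond {A B : GammaOp ⥤ TopCat.{u}} (α : A ⟶ B) (S : GammaOp) (x : A.obj S)
    (s : unitInterval) : (Bmu.map α).app S (bond A S x s) = bond B S (α.app S x) s :=
  -- Both sides are points with the same parameter on an edge. The two edges in `B([1] ∧ S)` agree
  -- by naturality of `α` at the isomorphism `S ≅ [1] ∧ S`.
  congrArg (fun y => GReal.mk (Y := circle ⋙ smash.obj S ⋙ B) (SimplexCategory.mk 1) y (edge s))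
    (NatTrans.naturality_apply α (toSmash S) x)

/-- The map of bar constructions applies `f` to each entry and leaves the simplex coordinate alone,
so a one-entry simplex `x` goes to the one-entry simplex `f x`. -/
theorem KMonoid.BMap_bond {M N : KMonoid.{u}} (f : M.carrier →ₜ* N.carrier) (x : M.carrier)
    (s : unitInterval) : KMonoid.BMap f (M.bond x s) = N.bond (f x) s := rfl

end EHI

/-! ### The main theorem -/

/-- Compatibility with the structure maps into loop spaces is expressed through their adjoints, the
maps `bond` with an explicit parameter `s ∈ I`. The equations for `F` fix the delooped maps as the
functorially induced ones. -/
theorem mainTheorem9 (G : EHIGroup.{u}) (R : CommSymRingSpectrum.{u}) (a : EHIAction G R) :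
    ∃ φ : IMonoidHom G.toIMonoid R.Omega.toIMonoid,
      -- the map sends `g` to the loop `t ↦ g · η_n(t)`
      (∀ (n : ℕ) (g : G.obj n) (t : Fin n → unitInterval),
        CommSymRingSpectrum.toLoop (φ.app n g) t = a.κ n g (R.eta n t)) ∧
      (G.CompatibleInverses →
        -- it factors through the units
        ∃ ψ : IMonoidHom G.toCommIMonoid.toIMonoid R.gl1.toIMonoid,
          (∀ (n : ℕ) (g : G.obj n), (ψ.app n g).1 = φ.app n g) ∧
          -- the induced map of `Γ`-spaces deloops
          (∃ F : Bmu.obj G.toCommIMonoid.Gam ⟶ Bmu.obj R.gl1.Gam,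
            F = Bmu.map (CommIMonoid.GamMap ψ) ∧
            ∀ (S : GammaOp) (x : G.toCommIMonoid.Gam.obj S) (s : unitInterval),
              F.app S (bond G.toCommIMonoid.Gam S x s) =
                bond R.gl1.Gam S ((CommIMonoid.GamMap ψ).app S x) s) ∧
          -- the induced map of topological monoids deloops
          ∃ f : G.toIMonoid.hMonoid.carrier →ₜ* R.GL1.carrier,
            (∀ x : G.toIMonoid.hI, f x = ψ.hMap x) ∧
            ∃ F : G.toIMonoid.hMonoid.B ⟶ R.GL1.B,
              F = KMonoid.BMap f ∧
              ∀ (x : G.toIMonoid.hMonoid.carrier) (s : unitInterval),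
                F (KMonoid.bond _ x s) = KMonoid.bond _ (f x) s) := by
  refine ⟨a.toOmega, fun n g t => rfl, fun hG => ?_⟩
  -- This is `φ` with its codomain restricted. Stable inverses are found in `G` itself, where
  -- compatible inverses supply the paths, and are then transported along `φ`.
  let ψ : IMonoidHom G.toCommIMonoid.toIMonoid R.gl1.toIMonoid :=
    a.toOmega.toUnits fun n g => a.toOmega.hasStableInverse (hG.hasStableInverse g)
  -- Both deloopings come from functoriality applied to this one `ψ`: through `Γ` and `B_μ` for the
  -- `Γ`-spaces, and through the homotopy colimit and the bar construction for the monoids.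
  exact ⟨ψ, fun n g => rfl,
    ⟨Bmu.map (CommIMonoid.GamMap ψ), rfl, Bmu_map_bond (CommIMonoid.GamMap ψ)⟩,
    ψ.hMonoidHom, fun x => rfl, KMonoid.BMap ψ.hMonoidHom, rfl, KMonoid.BMap_bond ψ.hMonoidHom⟩
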